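/- For a complex number $x$ and an integer $n\ge 0$ let $(x)_n=x(x+1)\cdots(x+n-1)$, and for complex $a$ let $(x)_a=\Gamma(x+a)/\Gamma(x)$ (so that $1/(x)_a=\Gamma(x)/\Gamma(x+a)$ is read as $0$ where $x+a$ is a pole of $\Gamma$). For every complex $a\notin\{-1,-2,-3,\dots\}$ the series $$f(a)=\sum_{n=0}^{\infty}\frac{(-1)^n3^{3n}}{2^{9n}}\,\frac{\left(a+\frac12\right)_n\left(a+\frac16\right)_n\left(a+\frac56\right)_n}{(a+1)_n^3}\,[154(n+a)+15]$$ converges absolutely, and the following hold. (i) For every complex $a$ with $\operatorname{Re} a>0$, $$f(a)=128a\sum_{n=0}^{\infty}\frac{\left(\frac a2+\frac14\right)_n\left(\frac a2+\frac34\right)_n}{(a+1)_n(2a+1)_n},$$ the series on the right being absolutely convergent. (ii) For every complex $a\notin\{-1,-2,-3,\dots\}$ with $\cos\pi a\ne0$, $$f(a)=\frac{32\sqrt2}{\pi}\cdot\frac{512^a}{27^a\cos\pi a}\cdot\frac{(1)_a^3}{\left(\frac12\right)_a\left(\frac16\right)_a\left(\frac56\right)_a}+\frac{512a^2}{2a-1}\sum_{n=0}^{\infty}\frac1{2^n}\,\frac{\left(a+\frac12\right)_n\left(3a+\frac12\right)_n}{(2a+1)_n\left(\frac32-a\right)_n},$$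 the series on the right being absolutely convergent. (iii) $f\left(\frac12\right)=128\ln2$; moreover $f$ is analytic at $0$ and $$f(0)=\frac{32\sqrt2}{\pi},\qquad f'(0)=\frac{480\sqrt2}{\pi}\ln2,\qquad f''(0)=\frac{32\sqrt2}{\pi}\left(225\ln^22-11\pi^2\right).$$ -/

import Mathlib

noncomputable section

/-- The rising factorial `(x)_n = x (x + 1) ⋯ (x + n - 1)` for a natural number `n`. -/
def rising (x : ℂ) (n : ℕ) : ℂ := (ascPochhammer ℂ n).eval x

/-- The rising factorial `(x)_a = Γ(x + a) / Γ(x)` for a complex number `a`; it is used only for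
`x` that is not a pole of `Γ`. Where `x + a` is a pole of `Γ`, Mathlib's `Complex.Gamma` is `0`, so
that `1 / (x)_a` is `0` there, as it is for the entire function `a ↦ Γ(x) / Γ(x + a)`. -/
def risingC (x a : ℂ) : ℂ := Complex.Gamma (x + a) / Complex.Gamma x

/-- The `n`-th term of the extended Ramanujan-type series `f(a)`. -/
def ramanujanTerm (a : ℂ) (n : ℕ) : ℂ :=
  ((-1) ^ n * 3 ^ (3 * n) / 2 ^ (9 * n)) *
    (rising (a + 1 / 2) n * rising (a + 1 / 6) n * rising (a + 5 / 6) n / rising (a + 1) n ^ 3) *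
    (154 * (n + a) + 15)

/-- The extended Ramanujan-type series `f(a)`. -/
def ramanujanSeries (a : ℂ) : ℂ := ∑' n : ℕ, ramanujanTerm a n

/-- The `n`-th term of the hypergeometric series in the first evaluation of `f(a)`. -/
def firstTerm (a : ℂ) (n : ℕ) : ℂ :=
  rising (a / 2 + 1 / 4) n * rising (a / 2 + 3 / 4) n / (rising (a + 1) n * rising (2 * a + 1) n)

/-- The `n`-th term of the hypergeometric series in the second evaluation of `f(a)`. -/
def secondTerm (a : ℂ) (n : ℕ) : ℂ :=
  1 / 2 ^ n * (rising (a + 1 / 2) n * rising (3 * a + 1 / 2) n /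
    (rising (2 * a + 1) n * rising (3 / 2 - a) n))

end

noncomputable section
open Filter Topology

/-! Write r(a) for `shiftRatio a`. Splitting off the first term of f gives f(a) = 154a + 15 + r(a)
f(a+1), and the whole proof compares solutions of this equation.

(i) The right-hand side 128a Σ `firstTerm` solves the same equation: the termwise difference
telescopes through the rational certificate `firstCert`, whose initial value is 154a + 15. The
difference d of two solutions satisfies d(a) = r(a) d(a+1). Since |r| ≤ 27/512 on Re a ≥ 0 and d
grows at most linearly, iteration forces d = 0 (`eq_zero_of_shiftRatio`).

(ii) The second series with its prefactor also solves the equation (certificate `secondCert`), but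
its denominators 2a - 1 and (3/2 - a)_n vanish at positive half-integers, so a homogeneous solution
survives. The function W = `gammaWeight` satisfies W(a+1) = -r(a) W(a). Hence W times the difference
`secondDiff` is antiperiodic, as is 1/cos(πa). On a strip slightly wider than one period the only
possible pole is a = 1/2, and cancelling it fixes the constant 32√2/π. What remains extends to an
entire antiperiodic function of linear growth in |Im a|. Its derivative is bounded, so Liouville's
theorem makes it vanish. The recursion carries the formula from the strip to all admissible a.

(iii) At a = 1/2 the first series is 2 ln 2, by partial fractions. Near 0 the second formula reads f
= (32√2/π) X(a) + a² k(a) with k analytic. Gauss triplication puts X in a form involving only Γ(1+a)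
and Γ(3a+1/2), so X'(0) = 15 ln 2. Reflection evaluates X(a)X(-a), which gives X''(0). Finally k(0)
comes from the arcsine series at √2/2. -/

/-! ### Rising factorials and the ratio test -/

theorem rising_zero (x : ℂ) : rising x 0 = 1 := by simp [rising]

theorem rising_succ (x : ℂ) (n : ℕ) : rising x (n + 1) = rising x n * (x + n) := by
  simp [rising, ascPochhammer_succ_eval]

theorem rising_succ_left (x : ℂ) (n : ℕ) : rising x (n + 1) = x * rising (x + 1) n := by
  simp [rising, ascPochhammer_succ_left]

theorem mul_rising_add_one (x : ℂ) (n : ℕ) : x * rising (x + 1) n = rising x n * (x + n) := by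
  rw [← rising_succ_left, rising_succ]

theorem rising_ne_zero {x : ℂ} (h : ∀ j : ℕ, x + j ≠ 0) (n : ℕ) : rising x n ≠ 0 := by
  induction n with
  | zero => simp [rising_zero]
  | succ n ih => rw [rising_succ]; exact mul_ne_zero ih (h n)

theorem differentiable_rising (n : ℕ) : Differentiable ℂ (fun x => rising x n) := by
  simpa [rising] using (ascPochhammer ℂ n).differentiable

/-- A sequence whose consecutive ratios tend to a number of modulus less than one is summable. -/
theorem summable_of_ratio_tendsto {u ρ : ℕ → ℂ} {c : ℂ} (h : ∀ n, u (n + 1) = ρ n * u n)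
    (hρ : Tendsto ρ atTop (𝓝 c)) (hc : ‖c‖ < 1) : Summable u := by
  obtain ⟨q, hq, hq1⟩ := exists_between hc
  refine summable_of_ratio_norm_eventually_le hq1 ?_
  filter_upwards [hρ.norm.eventually (gt_mem_nhds hq)] with n hn
  rw [h, norm_mul]
  gcongr

theorem tendsto_add_div_add (x y : ℂ) :
    Tendsto (fun n : ℕ => (x + n) / (y + n)) atTop (𝓝 1) := by
  have h : Tendsto (fun n : ℕ => (n : ℂ)⁻¹) atTop (𝓝 0) := tendsto_inv_atTop_nhds_zero_nat
  have h2 : Tendsto (fun n : ℕ => (x * (n : ℂ)⁻¹ + 1) / (y * (n : ℂ)⁻¹ + 1)) atTop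
      (𝓝 ((x * 0 + 1) / (y * 0 + 1))) :=
    Tendsto.div ((h.const_mul x).add_const 1) ((h.const_mul y).add_const 1) (by simp)
  simp only [mul_zero, zero_add, div_one] at h2
  refine h2.congr' ?_
  filter_upwards [eventually_gt_atTop 0] with n hn
  have : (n : ℂ) ≠ 0 := by exact_mod_cast hn.ne'
  rw [← mul_div_mul_right _ _ this]
  congr 1 <;> field_simp

/-- Polynomial weights do not affect summability by the ratio test. -/
theorem summable_pow_mul_of_ratio_tendsto {u ρ : ℕ → ℂ} {c : ℂ}
    (h : ∀ n, u (n + 1) = ρ n * u n) (hρ : Tendsto ρ atTop (𝓝 c)) (hc : ‖c‖ < 1) (d : ℕ) :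
    Summable fun n : ℕ => ((n : ℂ) + 1) ^ d * u n := by
  refine summable_of_ratio_tendsto (ρ := fun n => ((2 + n) / (1 + n)) ^ d * ρ n) (c := c)
    (fun n => ?_) (by simpa using ((tendsto_add_div_add 2 1).pow d).mul hρ) hc
  have : (1 + n : ℂ) ≠ 0 := by exact_mod_cast (by omega : 1 + n ≠ 0)
  rw [h, div_pow]
  push_cast
  field_simp
  ring

/-! ### The functional equation of f -/

/-- The coefficient relating `f(a)` and `f(a + 1)`. -/
def shiftRatio (a : ℂ) : ℂ :=
  -27 / 512 * ((a + 1 / 2) * (a + 1 / 6) * (a + 5 / 6) / (a + 1) ^ 3)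

theorem ramanujanTerm_zero (a : ℂ) : ramanujanTerm a 0 = 154 * a + 15 := by
  simp [ramanujanTerm, rising_zero]

/-- Every Pochhammer symbol loses its first factor, and these factors assemble to `shiftRatio a`.
With 1/0 = 0 the identity persists at negative integers. -/
theorem ramanujanTerm_succ (a : ℂ) (n : ℕ) :
    ramanujanTerm a (n + 1) = shiftRatio a * ramanujanTerm (a + 1) n := by
  simp only [ramanujanTerm, shiftRatio, rising_succ_left]
  rw [show a + 1 / 2 + 1 = a + 1 + 1 / 2 by ring, show a + 1 / 6 + 1 = a + 1 + 1 / 6 by ring,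
    show a + 5 / 6 + 1 = a + 1 + 5 / 6 by ring]
  push_cast
  rw [show 3 * (n + 1) = 3 * n + 3 by ring, show 9 * (n + 1) = 9 * n + 9 by ring]
  simp only [pow_add, div_eq_mul_inv, mul_inv, mul_pow]
  ring

/-- The hypergeometric coefficient of `f(a)`. -/
def ramanujanCoeff (a : ℂ) (n : ℕ) : ℂ :=
  ((-1) ^ n * 3 ^ (3 * n) / 2 ^ (9 * n)) *
    (rising (a + 1 / 2) n * rising (a + 1 / 6) n * rising (a + 5 / 6) n / rising (a + 1) n ^ 3)

theorem ramanujanCoeff_succ (a : ℂ) (n : ℕ) :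
    ramanujanCoeff a (n + 1) = -27 / 512 * ((a + 1 / 2 + n) / (a + 1 + n) *
      ((a + 1 / 6 + n) / (a + 1 + n)) * ((a + 5 / 6 + n) / (a + 1 + n))) * ramanujanCoeff a n := by
  simp only [ramanujanCoeff, rising_succ]
  rw [show 3 * (n + 1) = 3 * n + 3 by ring, show 9 * (n + 1) = 9 * n + 9 by ring]
  simp only [pow_add, div_eq_mul_inv, mul_inv, mul_pow, ← inv_pow]
  generalize (a + 1 + (n : ℂ))⁻¹ = z
  ring

theorem ramanujanTerm_eq (a : ℂ) (n : ℕ) :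
    ramanujanTerm a n = 154 * (((n : ℂ) + 1) ^ 1 * ramanujanCoeff a n) +
      (154 * a - 139) * (((n : ℂ) + 1) ^ 0 * ramanujanCoeff a n) := by
  simp only [ramanujanTerm, ramanujanCoeff]
  ring

theorem summable_ramanujanTerm (a : ℂ) : Summable (ramanujanTerm a) := by
  have key := summable_pow_mul_of_ratio_tendsto (ramanujanCoeff_succ a) (c := -27 / 512)
    (by
      have := (((tendsto_add_div_add (a + 1 / 2) (a + 1)).mul
        (tendsto_add_div_add (a + 1 / 6) (a + 1))).mul
        (tendsto_add_div_add (a + 5 / 6) (a + 1))).const_mul (-27 / 512 : ℂ)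
      simpa only [mul_one] using this) (by norm_num)
  rw [funext (ramanujanTerm_eq a)]
  exact ((key 1).mul_left _).add ((key 0).mul_left _)

theorem ramanujanSeries_eq_add (a : ℂ) :
    ramanujanSeries a = 154 * a + 15 + shiftRatio a * ramanujanSeries (a + 1) := by
  rw [ramanujanSeries, (summable_ramanujanTerm a).tsum_eq_zero_add, ramanujanTerm_zero,
    ramanujanSeries, ← tsum_mul_left]
  simp only [ramanujanTerm_succ]


/-! ### Growth of f on the right half-plane -/

/-- If w is no steeper than z, then |w|/|z| ≤ Re w/Re z. This lets complex ratios be majorised by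
ratios of real parts. -/
theorem norm_mul_re_le {w z : ℂ} (hw : 0 ≤ w.re) (hz : 0 ≤ z.re)
    (h : |w.im| * z.re ≤ w.re * |z.im|) : ‖w‖ * z.re ≤ w.re * ‖z‖ := by
  refine abs_le_of_sq_le_sq' ?_ (by positivity) |>.2
  have h2 := pow_le_pow_left₀ (by positivity) h 2
  simp only [mul_pow, sq_abs] at h2
  rw [mul_pow, mul_pow, Complex.sq_norm, Complex.sq_norm, Complex.normSq_apply,
    Complex.normSq_apply]
  nlinarith

theorem norm_le_norm_of_abs_re_le {w z : ℂ} (h : |w.re| ≤ z.re) (him : w.im = z.im) :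
    ‖w‖ ≤ ‖z‖ := by
  have h0 : 0 ≤ z.re := (abs_nonneg _).trans h
  refine abs_le_of_sq_le_sq' ?_ (by positivity) |>.2
  rw [Complex.sq_norm, Complex.sq_norm, Complex.normSq_apply, Complex.normSq_apply, him]
  have := pow_le_pow_left₀ (abs_nonneg _) h 2
  rw [sq_abs] at this
  nlinarith

theorem ne_zero_of_re_pos {z : ℂ} (h : 0 < z.re) : z ≠ 0 := by
  rintro rfl
  simp at h

theorem norm_ratio_le_one {w z : ℂ} (h0 : 0 ≤ w.re) (h : w.re ≤ z.re) (him : w.im = z.im) :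
    ‖w / z‖ ≤ 1 := by
  rw [norm_div]
  exact div_le_one_of_le₀ (norm_le_norm_of_abs_re_le (by rwa [abs_of_nonneg h0]) him) (norm_nonneg _)

theorem norm_three_ratios_le {a : ℂ} (ha : 0 ≤ a.re) (n : ℕ) :
    ‖-27 / 512 * ((a + 1 / 2 + n) / (a + 1 + n) *
      ((a + 1 / 6 + n) / (a + 1 + n)) * ((a + 5 / 6 + n) / (a + 1 + n)))‖ ≤ 27 / 512 := by
  have hn : (0 : ℝ) ≤ n := n.cast_nonneg
  have h1 : ∀ c : ℝ, 0 ≤ c → c ≤ 1 → ‖(a + c + n) / (a + 1 + n)‖ ≤ 1 := fun c h0 h1 =>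
    norm_ratio_le_one (by simp; linarith) (by simp; linarith) (by simp)
  have e1 := h1 (1 / 2) (by norm_num) (by norm_num)
  have e2 := h1 (1 / 6) (by norm_num) (by norm_num)
  have e3 := h1 (5 / 6) (by norm_num) (by norm_num)
  push_cast at e1 e2 e3
  rw [norm_mul, norm_mul, norm_mul, show ‖(-27 / 512 : ℂ)‖ = 27 / 512 by norm_num]
  have : ‖(a + 1 / 2 + n) / (a + 1 + n)‖ * ‖(a + 1 / 6 + n) / (a + 1 + n)‖ *
      ‖(a + 5 / 6 + n) / (a + 1 + n)‖ ≤ 1 :=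
    mul_le_one₀ (mul_le_one₀ e1 (norm_nonneg _) e2) (norm_nonneg _) e3
  linarith

theorem norm_shiftRatio_le {a : ℂ} (ha : 0 ≤ a.re) : ‖shiftRatio a‖ ≤ 27 / 512 := by
  have h := norm_three_ratios_le ha 0
  have e : shiftRatio a = -27 / 512 * ((a + 1 / 2 + (0 : ℕ)) / (a + 1 + (0 : ℕ)) *
      ((a + 1 / 6 + (0 : ℕ)) / (a + 1 + (0 : ℕ))) * ((a + 5 / 6 + (0 : ℕ)) / (a + 1 + (0 : ℕ)))) := by
    simp only [shiftRatio, Nat.cast_zero, add_zero]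
    rw [pow_three']
    simp only [div_eq_mul_inv, mul_inv]
    ring
  rwa [e]

theorem norm_ramanujanCoeff_le {a : ℂ} (ha : 0 ≤ a.re) (n : ℕ) :
    ‖ramanujanCoeff a n‖ ≤ (27 / 512) ^ n := by
  induction n with
  | zero => simp [ramanujanCoeff, rising_zero]
  | succ n ih =>
    rw [ramanujanCoeff_succ, norm_mul, pow_succ']
    exact mul_le_mul (norm_three_ratios_le ha n) ih (norm_nonneg _) (by norm_num)

theorem norm_ramanujanTerm_le {a : ℂ} (ha : 0 ≤ a.re) (n : ℕ) :
    ‖ramanujanTerm a n‖ ≤ (169 * ((n + 1) * (27 / 512) ^ n)) * (1 + ‖a‖) := by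
  have h1 := norm_ramanujanCoeff_le ha n
  -- 169 = 154 + 15.
  have h2 : ‖154 * ((n : ℂ) + a) + 15‖ ≤ 169 * (n + 1) * (1 + ‖a‖) := by
    calc ‖154 * ((n : ℂ) + a) + 15‖ ≤ 154 * (n + ‖a‖) + 15 := by
          refine (norm_add_le _ _).trans ?_
          rw [norm_mul]
          have := norm_add_le (n : ℂ) a
          simp only [Complex.norm_natCast, Complex.norm_ofNat] at this ⊢
          linarith
      _ ≤ _ := by
          have := norm_nonneg a
          have hn : (0 : ℝ) ≤ n := n.cast_nonneg
          nlinarith [mul_nonneg hn this]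
  have e : ramanujanTerm a n = ramanujanCoeff a n * (154 * (n + a) + 15) := rfl
  rw [e, norm_mul]
  calc _ ≤ (27 / 512 : ℝ) ^ n * (169 * (n + 1) * (1 + ‖a‖)) := by gcongr
    _ = _ := by ring

theorem summable_ramanujanBound :
    Summable fun n : ℕ => (169 : ℝ) * ((n + 1) * (27 / 512) ^ n) := by
  refine Summable.mul_left _ ?_
  have h1 := summable_pow_mul_geometric_of_norm_lt_one 1 (r := (27 / 512 : ℝ)) (by norm_num)
  have h2 := summable_geometric_of_lt_one (r := (27 / 512 : ℝ)) (by norm_num) (by norm_num)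
  refine (h1.add h2).congr fun n => ?_
  ring

theorem exists_norm_ramanujanSeries_le :
    ∃ K : ℝ, 0 ≤ K ∧ ∀ a : ℂ, 0 ≤ a.re → ‖ramanujanSeries a‖ ≤ K * (1 + ‖a‖) := by
  refine ⟨∑' n : ℕ, (169 : ℝ) * ((n + 1) * (27 / 512) ^ n), tsum_nonneg fun n => by positivity,
    fun a ha => ?_⟩
  rw [← tsum_mul_right]
  exact tsum_of_norm_bounded (summable_ramanujanBound.mul_right _).hasSum
    (norm_ramanujanTerm_le ha)

/-! ### The first hypergeometric series -/

theorem firstTerm_zero (a : ℂ) : firstTerm a 0 = 1 := by simp [firstTerm, rising_zero]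

theorem firstTerm_succ (a : ℂ) (n : ℕ) : firstTerm a (n + 1) =
    (a / 2 + 1 / 4 + n) / (2 * a + 1 + n) * ((a / 2 + 3 / 4 + n) / (a + 1 + n)) *
      firstTerm a n := by
  simp only [firstTerm, rising_succ, div_eq_mul_inv, mul_inv]
  ring

/-- The value of `firstTerm` at a real argument, as a real product. -/
def firstBound (x : ℝ) : ℕ → ℝ
  | 0 => 1
  | n + 1 => (x / 2 + 1 / 4 + n) / (2 * x + 1 + n) * ((x / 2 + 3 / 4 + n) / (x + 1 + n)) *
      firstBound x n

theorem firstBound_pos {x : ℝ} (hx : 0 < x) (n : ℕ) : 0 < firstBound x n := by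
  induction n with
  | zero => exact one_pos
  | succ n ih => rw [firstBound]; positivity

/-- In each factor of the term ratio the numerator is no steeper than the denominator, so replacing
a by Re a can only increase the modulus. -/
theorem norm_firstTerm_le {a : ℂ} (ha : 0 < a.re) (n : ℕ) :
    ‖firstTerm a n‖ ≤ firstBound a.re n := by
  induction n with
  | zero => simp [firstTerm_zero, firstBound]
  | succ n ih =>
    have hn : (0 : ℝ) ≤ n := n.cast_nonneg
    have key : ∀ w z : ℂ, 0 ≤ w.re → 0 < z.re → |w.im| * z.re ≤ w.re * |z.im| →
        ‖w / z‖ ≤ w.re / z.re := fun w z hw hz h => by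
      rw [norm_div, div_le_div_iff₀ (norm_pos_iff.2 (ne_zero_of_re_pos hz)) hz]
      exact norm_mul_re_le hw hz.le h
    have hi : 0 ≤ |a.im| := abs_nonneg _
    have h1 := key (a / 2 + 1 / 4 + n) (2 * a + 1 + n) (by simp; linarith) (by simp; linarith)
      (by simp [abs_mul, abs_div]; nlinarith [mul_nonneg hi hn])
    have h2 := key (a / 2 + 3 / 4 + n) (a + 1 + n) (by simp; linarith) (by simp; linarith)
      (by simp [abs_div]; nlinarith [mul_nonneg hi hn])
    rw [firstTerm_succ, firstBound, norm_mul, norm_mul]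
    have e1 : (a / 2 + 1 / 4 + n).re / (2 * a + 1 + n).re =
      (a.re / 2 + 1 / 4 + n) / (2 * a.re + 1 + n) := by simp
    have e2 : (a / 2 + 3 / 4 + n).re / (a + 1 + n).re =
      (a.re / 2 + 3 / 4 + n) / (a.re + 1 + n) := by simp
    rw [e1] at h1
    rw [e2] at h2
    gcongr

/-- A Raabe-type estimate. The terms decay like n^(-1-2x), so the decrement of (n+1)u_n is about 2x
u_n. The smaller constant x/(2(x+1)) works for every n, because after clearing denominators the
difference is a polynomial with nonnegative coefficients. -/
theorem firstBound_telescope {x : ℝ} (hx : 0 < x) (n : ℕ) :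
    x / (2 * (x + 1)) * firstBound x n ≤
      (n + 1) * firstBound x n - ((n + 1 : ℕ) + 1) * firstBound x (n + 1) := by
  have hn : (0 : ℝ) ≤ n := n.cast_nonneg
  have hu := (firstBound_pos hx n).le
  have : x / (2 * (x + 1)) ≤ (n + 1) - (n + 2) * ((x / 2 + 1 / 4 + n) / (2 * x + 1 + n) *
      ((x / 2 + 3 / 4 + n) / (x + 1 + n))) := by
    rw [div_mul_div_comm, ← sub_nonneg]
    have e : (n : ℝ) + 1 - (n + 2) * ((x / 2 + 1 / 4 + n) * (x / 2 + 3 / 4 + n) /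
        ((2 * x + 1 + n) * (x + 1 + n))) - x / (2 * (x + 1)) =
      ((2 * (x + 1)) * ((n + 1) * ((2 * x + 1 + n) * (x + 1 + n)) -
        (n + 2) * ((x / 2 + 1 / 4 + n) * (x / 2 + 3 / 4 + n))) -
        x * ((2 * x + 1 + n) * (x + 1 + n))) /
      ((2 * (x + 1)) * ((2 * x + 1 + n) * (x + 1 + n))) := by
      field_simp
    rw [e]
    apply div_nonneg _ (by positivity)
    have : (2 * (x + 1)) * ((n + 1) * ((2 * x + 1 + n) * (x + 1 + n)) -
        (n + 2) * ((x / 2 + 1 / 4 + n) * (x / 2 + 3 / 4 + n))) -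
        x * ((2 * x + 1 + n) * (x + 1 + n)) =
      n ^ 2 * (4 * x ^ 2 + 3 * x) + n * (7 / 2 * x ^ 3 + 15 / 2 * x ^ 2 + 53 / 8 * x + 13 / 8) +
        (x ^ 3 + 4 * x ^ 2 + 17 / 4 * x + 5 / 4) := by ring
    rw [this]
    positivity
  have h := mul_le_mul_of_nonneg_right this hu
  rw [firstBound]
  push_cast
  calc _ ≤ _ := h
    _ = _ := by ring

/-- A nonnegative sequence dominated by the decrements of a nonnegative sequence is summable. -/
theorem summable_of_telescope {u v : ℕ → ℝ} {δ : ℝ} (hδ : 0 < δ) (hu : ∀ n, 0 ≤ u n)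
    (hv : ∀ n, 0 ≤ v n) (h : ∀ n, δ * u n ≤ v n - v (n + 1)) :
    Summable u ∧ ∑' n, u n ≤ v 0 / δ := by
  have hb : ∀ n, ∑ i ∈ Finset.range n, u i ≤ v 0 / δ := fun n => by
    rw [le_div_iff₀ hδ, mul_comm, Finset.mul_sum]
    calc _ ≤ ∑ i ∈ Finset.range n, (v i - v (i + 1)) := Finset.sum_le_sum fun i _ => h i
      _ = v 0 - v n := Finset.sum_range_sub' _ _
      _ ≤ v 0 := by linarith [hv n]
  exact ⟨summable_of_sum_range_le hu hb, Real.tsum_le_of_sum_range_le hu hb⟩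

theorem summable_firstBound {x : ℝ} (hx : 0 < x) :
    Summable (firstBound x) ∧ ∑' n, firstBound x n ≤ 1 / (x / (2 * (x + 1))) := by
  have h := summable_of_telescope (u := firstBound x) (v := fun n => (n + 1) * firstBound x n)
    (δ := x / (2 * (x + 1))) (by positivity) (fun n => (firstBound_pos hx n).le)
    (fun n => mul_nonneg (by positivity) (firstBound_pos hx n).le) (firstBound_telescope hx)
  simpa [firstBound] using h

/-- The sequence (n+1)u_n decreases by `firstBound_telescope`, so it has a limit L ≥ 0. If L > 0,
then u_n ≥ L/(n+1) and the harmonic series would converge. -/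
theorem tendsto_mul_firstBound {x : ℝ} (hx : 0 < x) :
    Tendsto (fun n : ℕ => (n + 1) * firstBound x n) atTop (𝓝 0) := by
  have hnn : ∀ n : ℕ, 0 ≤ (n + 1) * firstBound x n := fun n =>
    mul_nonneg (by positivity) (firstBound_pos hx n).le
  have hanti : Antitone fun n : ℕ => (n + 1) * firstBound x n := antitone_nat_of_succ_le fun n => by
    have := firstBound_telescope hx n
    have h2 : 0 ≤ x / (2 * (x + 1)) * firstBound x n :=
      mul_nonneg (by positivity) (firstBound_pos hx n).le
    linarith
  have hbdd : BddBelow (Set.range fun n : ℕ => (n + 1) * firstBound x n) :=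
    ⟨0, by rintro _ ⟨n, rfl⟩; exact hnn n⟩
  have hlim := tendsto_atTop_ciInf hanti hbdd
  set L := ⨅ n : ℕ, (n + 1) * firstBound x n
  have hL0 : 0 ≤ L := le_ciInf hnn
  rcases hL0.eq_or_lt with h | hpos
  · rwa [← h] at hlim
  · exfalso
    have hle : ∀ n : ℕ, L / (n + 1) ≤ firstBound x n := fun n => by
      rw [div_le_iff₀ (by positivity), mul_comm]
      exact ciInf_le hbdd n
    have hs : Summable fun n : ℕ => L / ((n : ℝ) + 1) :=
      Summable.of_nonneg_of_le (fun n => by positivity) hle (summable_firstBound hx).1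
    have hs2 : Summable fun n : ℕ => 1 / ((n : ℝ)) := by
      rw [← summable_nat_add_iff 1]
      refine (hs.mul_left L⁻¹).congr fun n => ?_
      push_cast
      field_simp
    exact Real.not_summable_one_div_natCast hs2

theorem summable_firstTerm {a : ℂ} (ha : 0 < a.re) : Summable (firstTerm a) :=
  Summable.of_norm_bounded (summable_firstBound ha).1 (norm_firstTerm_le ha)

/-- Under a ↦ a+1 the numerator parameter a/2+1/4 becomes a/2+3/4, and a/2+3/4 becomes (a/2+1/4)+1.
The numerators therefore differ by a single factor, and the quotient of the terms is rational in k.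
-/
theorem firstTerm_shift {a : ℂ} (ha : 0 < a.re) (k : ℕ) : firstTerm (a + 1) k =
    firstTerm a k * ((2 * a + 1 + 4 * k) * (a + 1) * (2 * a + 2) /
      ((a + 1 + k) * (2 * a + 1 + k) * (2 * a + 2 + k))) := by
  have h1 : ∀ k : ℕ, a + 1 + k ≠ 0 := fun k => ne_zero_of_re_pos (by simp; positivity)
  have h2 : ∀ k : ℕ, 2 * a + 1 + k ≠ 0 := fun k => ne_zero_of_re_pos (by simp; positivity)
  have h3 : ∀ k : ℕ, 2 * a + 2 + k ≠ 0 := fun k => ne_zero_of_re_pos (by simp; positivity)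
  induction k with
  | zero =>
    have e1 := h1 0
    have e2 := h2 0
    have e3 := h3 0
    simp only [Nat.cast_zero, add_zero, mul_zero, firstTerm_zero] at *
    field_simp
  | succ k ih =>
    rw [firstTerm_succ, ih, firstTerm_succ]
    have e1 := h1 k
    have e2 := h2 k
    have e3 := h3 k
    have e4 := h1 (k + 1)
    have e6 := h3 (k + 1)
    push_cast at *
    rw [show (a + 1) / 2 + 1 / 4 + (k : ℂ) = (2 * a + 3 + 4 * k) / 4 by ring,
      show (a + 1) / 2 + 3 / 4 + (k : ℂ) = (2 * a + 5 + 4 * k) / 4 by ring,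
      show a / 2 + 1 / 4 + (k : ℂ) = (2 * a + 1 + 4 * k) / 4 by ring,
      show a / 2 + 3 / 4 + (k : ℂ) = (2 * a + 3 + 4 * k) / 4 by ring,
      show 2 * (a + 1) + 1 + (k : ℂ) = 2 * a + 2 + (k + 1) by ring,
      show a + 1 + 1 + (k : ℂ) = a + 1 + (k + 1) by ring,
      show 2 * a + 1 + ((k : ℂ) + 1) = 2 * a + 2 + k by ring]
    generalize firstTerm a k = u
    generalize ha1 : a + 1 + ((k : ℂ) + 1) = z1 at *
    generalize ha2 : 2 * a + 2 + ((k : ℂ) + 1) = z2 at *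
    generalize ha3 : 2 * a + 2 + (k : ℂ) = z3 at *
    generalize ha4 : 2 * a + 1 + (k : ℂ) = z4 at *
    generalize ha5 : a + 1 + (k : ℂ) = z5 at *
    field_simp
    ring

/-- The telescoping certificate for the first series. -/
def firstCert (a : ℂ) (k : ℕ) : ℂ :=
  firstTerm a k * ((15 + 184 * a + 308 * a ^ 2 + (76 + 264 * a) * k + 64 * k ^ 2) /
    (2 * a + 1 + k))

theorem firstCert_zero {a : ℂ} (ha : 0 < a.re) : firstCert a 0 = 154 * a + 15 := by
  have h2 : 2 * a + 1 ≠ 0 := ne_zero_of_re_pos (by simp; positivity)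
  simp only [firstCert, firstTerm_zero, Nat.cast_zero]
  rw [one_mul, add_zero, div_eq_iff h2]
  ring

theorem firstCert_telescope {a : ℂ} (ha : 0 < a.re) (k : ℕ) :
    128 * a * firstTerm a k - shiftRatio a * (128 * (a + 1)) * firstTerm (a + 1) k =
      firstCert a k - firstCert a (k + 1) := by
  have h0 : a + 1 ≠ 0 := ne_zero_of_re_pos (by simp; positivity)
  have h1 : a + 1 + k ≠ 0 := ne_zero_of_re_pos (by simp; positivity)
  have h2 : 2 * a + 1 + k ≠ 0 := ne_zero_of_re_pos (by simp; positivity)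
  have h3 : 2 * a + 2 + k ≠ 0 := ne_zero_of_re_pos (by simp; positivity)
  rw [firstTerm_shift ha, firstCert, firstCert, firstTerm_succ, shiftRatio]
  push_cast
  have h4 : a * 2 + 1 + k ≠ 0 := by rwa [mul_comm]
  rw [show 2 * a + 2 + (k : ℂ) = 2 * (a + 1) + k by ring] at *
  rw [show 2 * a + 1 + ((k : ℂ) + 1) = 2 * (a + 1) + k by ring]
  field_simp
  ring

/-- The certificate is `firstTerm` times a factor of linear growth in k, so summability alone would
not suffice. The limit (k+1)u_k → 0 is what is needed. -/
theorem tendsto_firstCert {a : ℂ} (ha : 0 < a.re) : Tendsto (firstCert a) atTop (𝓝 0) := by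
  set K := ‖15 + 184 * a + 308 * a ^ 2‖ + ‖76 + 264 * a‖ + 64
  refine squeeze_zero_norm (a := fun k : ℕ => K * ((k + 1) * firstBound a.re k)) (fun k => ?_)
    (by simpa using (tendsto_mul_firstBound ha).const_mul K)
  have hk : (0 : ℝ) ≤ k := k.cast_nonneg
  have h1 : (k : ℝ) + 1 ≤ ‖2 * a + 1 + k‖ := by
    refine le_trans ?_ (Complex.re_le_norm _)
    simp
    linarith
  have h2 : ‖15 + 184 * a + 308 * a ^ 2 + (76 + 264 * a) * k + 64 * (k : ℂ) ^ 2‖ ≤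
      K * ((k + 1) * (k + 1)) := by
    refine (norm_add₃_le).trans ?_
    simp only [norm_mul, norm_pow, Complex.norm_natCast, Complex.norm_ofNat]
    have := norm_nonneg (15 + 184 * a + 308 * a ^ 2)
    have := norm_nonneg (76 + 264 * a)
    have e : K * ((k + 1) * (k + 1)) = ‖15 + 184 * a + 308 * a ^ 2‖ * ((k + 1) * (k + 1)) +
      ‖76 + 264 * a‖ * ((k + 1) * (k + 1)) + 64 * ((k + 1) * (k + 1)) := by ring
    rw [e]
    refine add_le_add (add_le_add (le_mul_of_one_le_right ?_ ?_)
      (mul_le_mul_of_nonneg_left ?_ ?_)) ?_ <;> first | positivity | nlinarith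
  rw [firstCert, norm_mul, norm_div]
  calc _ ≤ firstBound a.re k * (K * ((k + 1) * (k + 1)) / (k + 1)) := by
        gcongr
        · exact (firstBound_pos ha k).le
        · exact norm_firstTerm_le ha k
    _ = _ := by field_simp

/-- The first hypergeometric evaluation satisfies the functional equation of `f`. -/
theorem tsum_firstTerm_shift {a : ℂ} (ha : 0 < a.re) :
    128 * a * ∑' n, firstTerm a n =
      154 * a + 15 + shiftRatio a * (128 * (a + 1) * ∑' n, firstTerm (a + 1) n) := by
  have ha1 : 0 < (a + 1).re := by simp; positivity
  have h1 := ((summable_firstTerm ha).hasSum.mul_left (128 * a)).sub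
    ((summable_firstTerm ha1).hasSum.mul_left (shiftRatio a * (128 * (a + 1))))
  have h2 := h1.tendsto_sum_nat
  simp only [firstCert_telescope ha, Finset.sum_range_sub', firstCert_zero ha] at h2
  have h3 := (tendsto_firstCert ha).const_sub (154 * a + 15)
  have := tendsto_nhds_unique h2 h3
  linear_combination this

theorem norm_tsum_firstTerm_le {b : ℂ} (hb : 1 ≤ b.re) : ‖∑' n, firstTerm b n‖ ≤ 4 := by
  have hb0 : 0 < b.re := by linarith
  refine (tsum_of_norm_bounded (summable_firstBound hb0).1.hasSum
    (norm_firstTerm_le hb0)).trans ((summable_firstBound hb0).2.trans ?_)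
  -- The bound 2(x+1)/x is at most 4 for x ≥ 1.
  rw [one_div_div, div_le_iff₀ hb0]
  linarith

/-- N steps of the recursion bound |d(a)| by (27/512)^N times a quantity linear in N. -/
theorem eq_zero_of_shiftRatio {d : ℂ → ℂ} {K : ℝ}
    (hd : ∀ a, 0 < a.re → d a = shiftRatio a * d (a + 1))
    (hK : ∀ b, 1 ≤ b.re → ‖d b‖ ≤ K * (1 + ‖b‖)) {a : ℂ} (ha : 0 < a.re) : d a = 0 := by
  have key : ∀ N : ℕ, ‖d a‖ ≤ (27 / 512) ^ N * ‖d (a + N)‖ := by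
    intro N
    induction N with
    | zero => simp
    | succ N ih =>
      refine ih.trans ?_
      have hN : 0 < (a + N).re := by simp; positivity
      rw [hd _ hN, norm_mul, pow_succ, mul_assoc]
      push_cast
      rw [← add_assoc]
      gcongr
      exact norm_shiftRatio_le hN.le
  have hK0 : 0 ≤ K := by
    have := (norm_nonneg _).trans (hK 1 (by simp))
    have h2 : (0 : ℝ) < 1 + ‖(1 : ℂ)‖ := by positivity
    exact nonneg_of_mul_nonneg_left this h2
  have hlim : Tendsto (fun N : ℕ => K * ((1 + ‖a‖) * (27 / 512 : ℝ) ^ N + N * (27 / 512 : ℝ) ^ N))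
      atTop (𝓝 0) := by
    have h1 := tendsto_pow_atTop_nhds_zero_of_lt_one (r := (27 / 512 : ℝ)) (by norm_num) (by norm_num)
    have h2 := tendsto_self_mul_const_pow_of_lt_one (r := (27 / 512 : ℝ)) (by norm_num) (by norm_num)
    simpa using ((h1.const_mul (1 + ‖a‖)).add h2).const_mul K
  have : ‖d a‖ ≤ 0 := by
    refine ge_of_tendsto hlim ?_
    filter_upwards [eventually_ge_atTop 1] with N hN
    have hN' : (1 : ℝ) ≤ N := by exact_mod_cast hN
    refine (key N).trans ?_
    have h1 : ‖d (a + N)‖ ≤ K * (1 + (‖a‖ + N)) := by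
      refine (hK _ (by simp; linarith)).trans ?_
      gcongr
      exact (norm_add_le _ _).trans (by simp)
    calc _ ≤ (27 / 512 : ℝ) ^ N * (K * (1 + (‖a‖ + N))) := by gcongr
      _ = _ := by ring
  exact norm_le_zero_iff.1 this

theorem ramanujanSeries_eq_first {a : ℂ} (ha : 0 < a.re) :
    ramanujanSeries a = 128 * a * ∑' n, firstTerm a n := by
  obtain ⟨K, hK0, hK⟩ := exists_norm_ramanujanSeries_le
  rw [← sub_eq_zero]
  -- 512 = 128 · 4, the 4 coming from `norm_tsum_firstTerm_le`.
  refine eq_zero_of_shiftRatio (d := fun a => ramanujanSeries a - 128 * a * ∑' n, firstTerm a n)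
    (K := K + 512) (fun a ha => ?_) (fun b hb => ?_) ha
  · rw [tsum_firstTerm_shift ha, ramanujanSeries_eq_add a]
    ring
  · refine (norm_sub_le _ _).trans ?_
    have h1 := hK b (by linarith)
    have h2 := norm_tsum_firstTerm_le hb
    rw [norm_mul, norm_mul, Complex.norm_ofNat]
    have h3 : 128 * ‖b‖ * ‖∑' n, firstTerm b n‖ ≤ 128 * ‖b‖ * 4 := by gcongr
    nlinarith [norm_nonneg b]

/-! ### The value at a = 1/2 -/

theorem firstTerm_half (n : ℕ) :
    firstTerm (1 / 2) n = ((1 / ((2 * n + 1) * (n + 1)) : ℝ) : ℂ) := by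
  have h : ∀ m : ℕ, (m : ℂ) + 1 ≠ 0 := fun m => by exact_mod_cast m.succ_ne_zero
  have h' : ∀ m : ℕ, 2 * (m : ℂ) + 1 ≠ 0 := fun m => by exact_mod_cast (2 * m).succ_ne_zero
  induction n with
  | zero => simp [firstTerm_zero]
  | succ n ih =>
    rw [firstTerm_succ, ih]
    have e1 := h n
    have e2 := h' n
    have e3 := h (n + 1)
    have e4 := h' (n + 1)
    push_cast at *
    rw [show (1 / 2 : ℂ) / 2 + 1 / 4 + n = (2 * n + 1) / 2 by ring,
      show (1 / 2 : ℂ) / 2 + 3 / 4 + n = n + 1 by ring,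
      show 2 * (1 / 2 : ℂ) + 1 + n = n + 1 + 1 by ring,
      show (1 / 2 : ℂ) + 1 + n = (2 * (n + 1) + 1) / 2 by ring]
    field_simp

/-- 1/((2n+1)(n+1)) = 2(1/(2n+1) - 1/(2n+2)), and the alternating harmonic sum up to 2N is H_{2N} -
H_N. -/
theorem sum_range_eq_harmonic_sub (N : ℕ) :
    ∑ n ∈ Finset.range N, (1 / ((2 * n + 1) * (n + 1)) : ℝ) =
      2 * (harmonic (2 * N) - harmonic N : ℝ) := by
  induction N with
  | zero => simp
  | succ N ih =>
    rw [Finset.sum_range_succ, ih, show 2 * (N + 1) = 2 * N + 1 + 1 by ring, harmonic_succ,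
      harmonic_succ, harmonic_succ]
    push_cast
    field_simp
    ring

theorem tsum_firstTerm_half :
    ∑' n, firstTerm (1 / 2) n = ((2 * Real.log 2 : ℝ) : ℂ) := by
  have hs := summable_firstTerm (a := 1 / 2) (by norm_num)
  have h1 : Tendsto (fun N : ℕ => 2 * (harmonic (2 * N) - harmonic N : ℝ)) atTop
      (𝓝 (2 * Real.log 2)) := by
    have h := Real.tendsto_harmonic_sub_log
    have h2 : Tendsto (fun N : ℕ => 2 * N) atTop atTop :=
      tendsto_id.const_mul_atTop' (by norm_num)
    -- Euler's constant cancels between H_{2N} - ln 2N and H_N - ln N, leaving ln 2.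
    have h3 := (((h.comp h2).sub h).add_const (Real.log 2)).const_mul 2
    simp only [sub_self, zero_add] at h3
    refine h3.congr' ?_
    filter_upwards [eventually_gt_atTop 0] with N hN
    have : (N : ℝ) ≠ 0 := by exact_mod_cast hN.ne'
    simp only [Function.comp]
    push_cast
    rw [Real.log_mul (by norm_num) this]
    ring
  refine tendsto_nhds_unique hs.hasSum.tendsto_sum_nat ?_
  simp only [firstTerm_half, ← Complex.ofReal_sum, sum_range_eq_harmonic_sub]
  exact (Complex.continuous_ofReal.tendsto _).comp h1

theorem ramanujanSeries_half : ramanujanSeries (1 / 2) = 128 * (Real.log 2 : ℂ) := by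
  rw [ramanujanSeries_eq_first (by norm_num), tsum_firstTerm_half]
  push_cast
  ring


/-! ### The second hypergeometric series -/

theorem secondTerm_zero (a : ℂ) : secondTerm a 0 = 1 := by simp [secondTerm, rising_zero]

theorem secondTerm_succ (a : ℂ) (n : ℕ) : secondTerm a (n + 1) =
    1 / 2 * ((a + 1 / 2 + n) / (3 / 2 - a + n) * ((3 * a + 1 / 2 + n) / (2 * a + 1 + n))) *
      secondTerm a n := by
  simp only [secondTerm, rising_succ, div_eq_mul_inv, mul_inv, pow_succ]
  ring

theorem summable_pow_mul_secondTerm (a : ℂ) (d : ℕ) :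
    Summable fun n : ℕ => ((n : ℂ) + 1) ^ d * secondTerm a n := by
  refine summable_pow_mul_of_ratio_tendsto (secondTerm_succ a) (c := 1 / 2) ?_ (by norm_num) d
  have := ((tendsto_add_div_add (a + 1 / 2) (3 / 2 - a)).mul
    (tendsto_add_div_add (3 * a + 1 / 2) (2 * a + 1))).const_mul (1 / 2 : ℂ)
  simpa only [mul_one] using this

theorem summable_secondTerm (a : ℂ) : Summable (secondTerm a) := by
  simpa using summable_pow_mul_secondTerm a 0

/-- The prefactored terms of the second hypergeometric evaluation at `a + 1`, in terms of those
at `a`. -/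
theorem secondTerm_shift {a : ℂ} (h1 : a + 1 ≠ 0) (h2 : ∀ k : ℕ, 2 * a + 1 + k ≠ 0)
    (h3 : ∀ k : ℕ, 1 / 2 - a + k ≠ 0) (k : ℕ) :
    shiftRatio a * (512 * (a + 1) ^ 2 / (2 * (a + 1) - 1)) * secondTerm (a + 1) k =
      secondTerm a k * (8 * ((a + 1 / 2 + k) * (3 * a + 1 / 2 + k) * (3 * a + 3 / 2 + k) *
        (3 * a + 5 / 2 + k) * (1 / 2 - a + k)) /
          ((2 * a + 1) * (2 * a - 1) * ((2 * a + 1 + k) * (2 * a + 2 + k)))) := by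
  have n1 : 2 * a + 1 ≠ 0 := by simpa using h2 0
  have n2 : 1 / 2 - a ≠ 0 := by simpa using h3 0
  have n3 : 2 * a - 1 ≠ 0 := by
    intro h
    exact n2 (by linear_combination (-1 / 2 : ℂ) * h)
  have h2' : ∀ k : ℕ, 2 * a + 2 + k ≠ 0 := fun k => by
    have := h2 (k + 1)
    push_cast at this
    convert this using 1
    ring
  have r3 : rising (2 * a + 1) k ≠ 0 := rising_ne_zero h2 k
  have r3' : rising (2 * a + 2 + 1) k ≠ 0 := rising_ne_zero (fun j => by
    have := h2' (j + 1)
    push_cast at this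
    convert this using 1
    ring) k
  have r4' : rising (1 / 2 - a) k ≠ 0 := rising_ne_zero h3 k
  have r4 : rising (1 / 2 - a + 1) k ≠ 0 := rising_ne_zero (fun j => by
    have := h3 (j + 1)
    push_cast at this
    convert this using 1
    ring) k
  have e1 := mul_rising_add_one (a + 1 / 2) k
  have e2 := mul_rising_add_one (3 * a + 1 / 2) k
  have e2' := mul_rising_add_one (3 * a + 1 / 2 + 1) k
  have e2'' := mul_rising_add_one (3 * a + 1 / 2 + 1 + 1) k
  have e3 := mul_rising_add_one (2 * a + 1) k
  have e3' := mul_rising_add_one (2 * a + 1 + 1) k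
  have e4 := mul_rising_add_one (1 / 2 - a) k
  have f2 : (3 * a + 1 / 2) * (3 * a + 3 / 2) * (3 * a + 5 / 2) * rising (3 * (a + 1) + 1 / 2) k =
      rising (3 * a + 1 / 2) k * ((3 * a + 1 / 2 + k) * (3 * a + 3 / 2 + k) *
        (3 * a + 5 / 2 + k)) := by
    rw [show 3 * (a + 1) + 1 / 2 = 3 * a + 1 / 2 + 1 + 1 + 1 by ring]
    linear_combination (3 * a + 1 / 2) * (3 * a + 3 / 2) * e2'' +
      (3 * a + 1 / 2) * (3 * a + 5 / 2 + k) * e2' +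
      (3 * a + 3 / 2 + k) * (3 * a + 5 / 2 + k) * e2
  have f3 : (2 * a + 1) * (2 * (a + 1)) * rising (2 * a + 2 + 1) k =
      rising (2 * a + 1) k * ((2 * a + 1 + k) * (2 * a + 2 + k)) := by
    rw [show 2 * a + 2 + 1 = 2 * a + 1 + 1 + 1 by ring]
    linear_combination (2 * a + 1) * e3' + (2 * a + 2 + k) * e3
  have hr : shiftRatio a * (512 * (a + 1) ^ 2 / (2 * (a + 1) - 1)) =
      -((3 * a + 1 / 2) * (3 * a + 3 / 2) * (3 * a + 5 / 2)) / ((a + 1) * (2 * a + 1)) := by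
    rw [shiftRatio, show 2 * (a + 1) - 1 = 2 * a + 1 by ring]
    field_simp
    ring
  rw [hr, secondTerm, secondTerm, show a + 1 + 1 / 2 = a + 1 / 2 + 1 by ring,
    show 2 * (a + 1) + 1 = 2 * a + 2 + 1 by ring, show 3 / 2 - (a + 1) = 1 / 2 - a by ring,
    show 3 / 2 - a = 1 / 2 - a + 1 by ring]
  have k1 := h2 k
  have k2 := h2' k
  have k3 := h3 k
  generalize rising (3 * (a + 1) + 1 / 2) k = R2' at *
  generalize rising (3 * a + 1 / 2) k = R2 at *
  generalize rising (2 * a + 2 + 1) k = R3' at *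
  generalize rising (2 * a + 1) k = R3 at *
  generalize rising (1 / 2 - a) k = R4' at *
  generalize rising (1 / 2 - a + 1) k = R4 at *
  generalize rising (a + 1 / 2 + 1) k = R1' at *
  generalize rising (a + 1 / 2) k = R1 at *
  have g1 : R1' = R1 * (2 * (a + 1 / 2 + k)) / (2 * a + 1) := by
    rw [eq_div_iff n1]
    linear_combination 2 * e1
  have g3 : R3' = R3 * ((2 * a + 1 + k) * (2 * a + 2 + k)) / ((2 * a + 1) * (2 * (a + 1))) := by
    rw [eq_div_iff (mul_ne_zero n1 (mul_ne_zero two_ne_zero h1))]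
    linear_combination f3
  have g4 : R4' = -(R4 * (2 * a - 1)) / (2 * (1 / 2 - a + k)) := by
    rw [eq_div_iff (mul_ne_zero two_ne_zero k3)]
    linear_combination -2 * e4
  rw [g1, g3, g4]
  -- The relation `f2` is multiplied by a common factor rather than solved for the shifted symbol,
  -- since (3a+1/2)(3a+3/2)(3a+5/2) may vanish.
  have f2' := congrArg (fun z => z * (8 * R1 * (a + 1 / 2 + k) * (1 / 2 - a + k) / (2 ^ k * R3 * R4 *
    ((2 * a + 1) * (2 * a - 1) * ((2 * a + 1 + k) * (2 * a + 2 + k)))))) f2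
  refine Eq.trans ?_ (f2'.trans ?_)
  · generalize 1 / 2 - a + (k : ℂ) = z1 at *
    generalize 2 * a - 1 = z2 at *
    generalize 2 * a + 1 + (k : ℂ) = z3 at *
    generalize 2 * a + 2 + (k : ℂ) = z4 at *
    generalize 2 * a + 1 = z5 at *
    generalize a + 1 = z6 at *
    field_simp
    ring
  · generalize 2 * a + 1 + (k : ℂ) = z3 at *
    generalize 2 * a + 2 + (k : ℂ) = z4 at *
    generalize 2 * a - 1 = z2 at *
    generalize 2 * a + 1 = z5 at *
    field_simp

/-- The telescoping certificate for the second series. -/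
def secondCert (a : ℂ) (k : ℕ) : ℂ :=
  secondTerm a k * (2 * (2 * a + 1) ^ 2 * (154 * a + 15) + (92 + 440 * a) * (2 * a + 1) * k +
    (176 * a + 72) * k ^ 2 + 16 * k ^ 3) * ((1 / 2 - a + k) / (2 * a + 1 + k)) *
      (-1 / ((2 * a + 1) * (2 * a - 1)))

theorem secondCert_zero {a : ℂ} (h2 : 2 * a + 1 ≠ 0) (h3 : 2 * a - 1 ≠ 0) :
    secondCert a 0 = 154 * a + 15 := by
  simp only [secondCert, secondTerm_zero, Nat.cast_zero, add_zero]
  field_simp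
  ring

theorem secondCert_telescope {a : ℂ} (h1 : a + 1 ≠ 0) (h2 : ∀ k : ℕ, 2 * a + 1 + k ≠ 0)
    (h3 : ∀ k : ℕ, 1 / 2 - a + k ≠ 0) (k : ℕ) :
    512 * a ^ 2 / (2 * a - 1) * secondTerm a k -
      shiftRatio a * (512 * (a + 1) ^ 2 / (2 * (a + 1) - 1)) * secondTerm (a + 1) k =
      secondCert a k - secondCert a (k + 1) := by
  rw [secondTerm_shift h1 h2 h3, secondCert, secondCert, secondTerm_succ]
  have n1 : 2 * a + 1 ≠ 0 := by simpa using h2 0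
  have n2 : 2 * a - 1 ≠ 0 := by
    intro h
    exact h3 0 (by push_cast; linear_combination (-1 / 2 : ℂ) * h)
  have k1 := h2 k
  have k2 := h2 (k + 1)
  have k3 := h3 (k + 1)
  push_cast at *
  rw [show 1 / 2 - a + ((k : ℂ) + 1) = 3 / 2 - a + k by ring] at *
  rw [show 2 * a + 1 + ((k : ℂ) + 1) = 2 * a + 2 + k by ring] at *
  generalize secondTerm a k = u
  generalize (k : ℂ) = k at *
  obtain ⟨z3, hz3⟩ : ∃ z, z = 2 * a + 1 + k := ⟨_, rfl⟩
  obtain ⟨z4, hz4⟩ : ∃ z, z = 2 * a + 2 + k := ⟨_, rfl⟩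
  obtain ⟨z1, hz1⟩ : ∃ z, z = 3 / 2 - a + k := ⟨_, rfl⟩
  obtain ⟨z2, hz2⟩ : ∃ z, z = 2 * a - 1 := ⟨_, rfl⟩
  obtain ⟨z5, hz5⟩ : ∃ z, z = 2 * a + 1 := ⟨_, rfl⟩
  rw [← hz3] at k1
  rw [← hz4] at k2
  rw [← hz1] at k3
  rw [← hz2] at n2
  rw [← hz5] at n1
  rw [← hz3, ← hz4, ← hz1, ← hz2, ← hz5]
  field_simp
  simp only [hz3, hz4, hz5]
  ring

theorem tendsto_secondCert (a : ℂ) : Tendsto (secondCert a) atTop (𝓝 0) := by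
  have h := fun d => (summable_pow_mul_secondTerm a d).tendsto_atTop_zero
  set A := 2 * (2 * a + 1) ^ 2 * (154 * a + 15)
  set B := (92 + 440 * a) * (2 * a + 1)
  set C := 176 * a + 72
  -- The coefficients are those of A + Bk + Ck² + 16k³ rewritten in powers of k+1.
  have h2 := ((((h 3).const_mul 16).add ((h 2).const_mul (C - 48))).add
    ((h 1).const_mul (B - 2 * C + 48))).add ((h 0).const_mul (A - B + C - 16))
  have h3 := (h2.mul (tendsto_add_div_add (1 / 2 - a) (2 * a + 1))).mul_const
    (-1 / ((2 * a + 1) * (2 * a - 1)))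
  simp only [mul_zero, add_zero, zero_mul] at h3
  refine h3.congr fun k => ?_
  rw [secondCert]
  ring

theorem tsum_secondTerm_shift {a : ℂ} (h1 : a + 1 ≠ 0) (h2 : ∀ k : ℕ, 2 * a + 1 + k ≠ 0)
    (h3 : ∀ k : ℕ, 1 / 2 - a + k ≠ 0) :
    512 * a ^ 2 / (2 * a - 1) * ∑' n, secondTerm a n = 154 * a + 15 + shiftRatio a *
      (512 * (a + 1) ^ 2 / (2 * (a + 1) - 1) * ∑' n, secondTerm (a + 1) n) := by
  have n1 : 2 * a + 1 ≠ 0 := by simpa using h2 0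
  have n2 : 2 * a - 1 ≠ 0 := by
    intro h
    exact h3 0 (by push_cast; linear_combination (-1 / 2 : ℂ) * h)
  have l1 := ((summable_secondTerm a).hasSum.mul_left (512 * a ^ 2 / (2 * a - 1))).sub
    ((summable_secondTerm (a + 1)).hasSum.mul_left
      (shiftRatio a * (512 * (a + 1) ^ 2 / (2 * (a + 1) - 1))))
  have l2 := l1.tendsto_sum_nat
  simp only [secondCert_telescope h1 h2 h3, Finset.sum_range_sub', secondCert_zero n1 n2] at l2
  have l3 := (tendsto_secondCert a).const_sub (154 * a + 15)
  have := tendsto_nhds_unique l2 l3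
  linear_combination this

/-! ### Uniform bounds and holomorphy -/

/-- A bound for `secondTerm`, uniform on a vertical strip. -/
def secondBound : ℕ → ℝ
  | 0 => 1
  | n + 1 => 1 / 2 * ((15 / 8 + n) / (1 / 8 + n) * (3 / 2)) * secondBound n

theorem secondBound_pos (n : ℕ) : 0 < secondBound n := by
  induction n with
  | zero => exact one_pos
  | succ n ih => rw [secondBound]; positivity

theorem summable_secondBound : Summable secondBound := by
  have h : Summable fun n => (secondBound n : ℂ) := by
    refine summable_of_ratio_tendsto (c := 3 / 4)
      (ρ := fun n => 3 / 4 * ((15 / 8 + n) / (1 / 8 + n))) (fun n => ?_) ?_ (by norm_num)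
    · rw [secondBound]
      push_cast
      ring
    · simpa using (tendsto_add_div_add (15 / 8) (1 / 8)).const_mul (3 / 4 : ℂ)
  exact Complex.summable_ofReal.1 h

/-- The strip contains 0 and a full period around 1/2 but stays left of 3/2, so Re(3/2 - a) > 1/8.
The majorising ratio tends to 3/4. -/
theorem norm_secondTerm_le {a : ℂ} (h1 : -1 / 4 < a.re) (h2 : a.re < 11 / 8) (n : ℕ) :
    ‖secondTerm a n‖ ≤ secondBound n := by
  induction n with
  | zero => simp [secondTerm_zero, secondBound]
  | succ n ih =>
    have hn : (0 : ℝ) ≤ n := n.cast_nonneg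
    have e1 : ‖(a + 1 / 2 + n) / (3 / 2 - a + n)‖ ≤ (15 / 8 + n) / (1 / 8 + n) := by
      have q0 : 0 < (3 / 2 - a + n).re := by simp; linarith
      rw [norm_div, div_le_div_iff₀ (norm_pos_iff.2 (ne_zero_of_re_pos q0)) (by positivity)]
      -- The real part of the numerator is raised to 15/8+n and that of the denominator lowered to
      -- 1/8+n. The imaginary parts then agree up to sign, and the slope comparison applies.
      have q1 := norm_mul_re_le (w := ⟨15 / 8 + n, a.im⟩) (z := ⟨1 / 8 + n, -a.im⟩)
        (by simp; positivity) (by simp; positivity)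
        (by simp only [abs_neg]; nlinarith [abs_nonneg a.im])
      have q2 : ‖a + 1 / 2 + n‖ ≤ ‖(⟨15 / 8 + n, a.im⟩ : ℂ)‖ :=
        norm_le_norm_of_abs_re_le (by simp [abs_le]; constructor <;> linarith) (by simp)
      have q3 : ‖(⟨1 / 8 + n, -a.im⟩ : ℂ)‖ ≤ ‖3 / 2 - a + n‖ :=
        norm_le_norm_of_abs_re_le (by simp [abs_le]; constructor <;> linarith) (by simp)
      simp only at q1
      calc _ ≤ ‖(⟨15 / 8 + n, a.im⟩ : ℂ)‖ * (1 / 8 + n) := by gcongr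
        _ ≤ _ := q1
        _ ≤ _ := by gcongr
    -- 3/2 times the denominator has the same imaginary part as the numerator, so only real parts
    -- need comparing.
    have e2 : ‖(3 * a + 1 / 2 + n) / (2 * a + 1 + n)‖ ≤ 3 / 2 := by
      have q0 : 0 < (2 * a + 1 + n).re := by simp; linarith
      rw [norm_div, div_le_iff₀ (norm_pos_iff.2 (ne_zero_of_re_pos q0)),
        show (3 / 2 : ℝ) = ‖(3 / 2 : ℂ)‖ by norm_num, ← norm_mul]
      refine norm_le_norm_of_abs_re_le ?_ ?_
      · simp [abs_le]
        constructor <;> linarith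
      · simp
        ring
    rw [secondTerm_succ, secondBound, norm_mul, norm_mul, norm_mul,
      show ‖(1 / 2 : ℂ)‖ = 1 / 2 by norm_num]
    gcongr

theorem exists_norm_tsum_secondTerm_le : ∃ K : ℝ, 0 ≤ K ∧ ∀ a : ℂ, -1 / 4 < a.re →
    a.re < 11 / 8 → ‖∑' n, secondTerm a n‖ ≤ K :=
  ⟨∑' n, secondBound n, tsum_nonneg fun n => (secondBound_pos n).le, fun _ h1 h2 =>
    tsum_of_norm_bounded summable_secondBound.hasSum (norm_secondTerm_le h1 h2)⟩

theorem isOpen_strip (x y : ℝ) : IsOpen {a : ℂ | x < a.re ∧ a.re < y} :=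
  (isOpen_lt continuous_const Complex.continuous_re).inter
    (isOpen_lt Complex.continuous_re continuous_const)

theorem differentiableOn_tsum_secondTerm :
    DifferentiableOn ℂ (fun a => ∑' n, secondTerm a n) {a | -1 / 4 < a.re ∧ a.re < 11 / 8} := by
  refine Complex.differentiableOn_tsum_of_summable_norm summable_secondBound (fun n a ha => ?_)
    (isOpen_strip _ _) fun n a ha => norm_secondTerm_le ha.1 ha.2 n
  have hd := differentiable_rising n
  have d1 : rising (2 * a + 1) n ≠ 0 := rising_ne_zero (fun j => ne_zero_of_re_pos (by
    have : (0 : ℝ) ≤ j := j.cast_nonneg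
    simp
    linarith [ha.1])) n
  have d2 : rising (3 / 2 - a) n ≠ 0 := rising_ne_zero (fun j => ne_zero_of_re_pos (by
    have : (0 : ℝ) ≤ j := j.cast_nonneg
    simp
    linarith [ha.2])) n
  have c : ∀ g : ℂ → ℂ, Differentiable ℂ g → DifferentiableAt ℂ (fun a => rising (g a) n) a :=
    fun g hg => (hd.comp hg) a
  unfold secondTerm
  refine (((((c (fun a => a + 1 / 2) (by fun_prop)).mul
    (c (fun a => 3 * a + 1 / 2) (by fun_prop))).div ((c (fun a => 2 * a + 1) (by fun_prop)).mul
    (c (fun a => 3 / 2 - a) (by fun_prop))) (mul_ne_zero d1 d2)).const_mul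
      (1 / 2 ^ n))).differentiableWithinAt

theorem differentiableOn_ramanujanSeries :
    DifferentiableOn ℂ ramanujanSeries {a | 0 < a.re} := by
  intro a ha
  have ha' : 0 < a.re := ha
  -- The majorant grows linearly in |a|, so uniformity requires a bounded neighbourhood.
  have hopen : IsOpen ({b : ℂ | 0 < b.re} ∩ Metric.ball 0 (‖a‖ + 1)) :=
    (isOpen_lt continuous_const Complex.continuous_re).inter Metric.isOpen_ball
  have key : DifferentiableOn ℂ ramanujanSeries ({b : ℂ | 0 < b.re} ∩ Metric.ball 0 (‖a‖ + 1)) := by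
    refine Complex.differentiableOn_tsum_of_summable_norm
      (summable_ramanujanBound.mul_right (1 + (‖a‖ + 1))) (fun n b hb => ?_) hopen
      fun n b hb => (norm_ramanujanTerm_le (le_of_lt hb.1) n).trans ?_
    · have hd := differentiable_rising n
      have hb0 : 0 < b.re := hb.1
      have d1 : rising (b + 1) n ≠ 0 := rising_ne_zero (fun j => ne_zero_of_re_pos (by
        simp
        positivity)) n
      have c : ∀ g : ℂ → ℂ, Differentiable ℂ g → DifferentiableAt ℂ (fun a => rising (g a) n) b :=
        fun g hg => (hd.comp hg) b
      unfold ramanujanTerm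
      refine ((((((c (fun a => a + 1 / 2) (by fun_prop)).mul
        (c (fun a => a + 1 / 6) (by fun_prop))).mul (c (fun a => a + 5 / 6) (by fun_prop))).div
        ((c (fun a => a + 1) (by fun_prop)).pow 3) (pow_ne_zero 3 d1)).const_mul _).mul
          (by fun_prop)).differentiableWithinAt
    · have : ‖b‖ < ‖a‖ + 1 := by simpa using hb.2
      gcongr
  have : ({b : ℂ | 0 < b.re} ∩ Metric.ball 0 (‖a‖ + 1)) ∈ 𝓝 a :=
    hopen.mem_nhds ⟨ha, by simp⟩
  exact (key.differentiableAt this).differentiableWithinAt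


/-! ### Antiperiodic functions of linear growth -/

/-- An entire antiperiodic function of linear growth in the imaginary part vanishes. -/
theorem eq_zero_of_antiperiodic_of_linear_growth {H : ℂ → ℂ} (hd : Differentiable ℂ H)
    (hp : ∀ a, H (a + 1) = -H a) {K : ℝ} (hb : ∀ a, ‖H a‖ ≤ K * (1 + |a.im|)) (a : ℂ) :
    H a = 0 := by
  have hd' : Differentiable ℂ (deriv H) := hd.deriv
  have hK0 : 0 ≤ K := by simpa using (norm_nonneg _).trans (hb 0)
  have hbd : ∀ c, ‖deriv H c‖ ≤ 2 * K := fun c => by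
    have hR : 0 < 1 + |c.im| := by positivity
    -- Cauchy's estimate with radius 1+|Im c|: on the circle 1+|Im z| ≤ 2(1+|Im c|), so the radius
    -- cancels.
    have h1 := Complex.norm_deriv_le_of_forall_mem_sphere_norm_le (c := c)
      (C := K * (2 * (1 + |c.im|))) hR hd.diffContOnCl (fun z hz => (hb z).trans (by
        have h2 : |(z - c).im| ≤ ‖z - c‖ := Complex.abs_im_le_norm _
        have h3 : ‖z - c‖ = 1 + |c.im| := by simpa [dist_eq_norm] using hz
        have h4 : |z.im| ≤ |c.im| + |(z - c).im| := by
          have := abs_add_le c.im (z - c).im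
          simpa using this
        gcongr
        linarith))
    refine h1.trans (le_of_eq ?_)
    field_simp
  obtain ⟨c, hc⟩ := hd'.exists_const_forall_eq_of_bounded
    (isBounded_iff_forall_norm_le.2 ⟨2 * K, by rintro _ ⟨z, rfl⟩; exact hbd z⟩)
  -- The constant derivative is itself antiperiodic.
  have hc0 : c = 0 := by
    have h1 : deriv (fun a => H (a + 1)) 0 = deriv (fun a => -H a) 0 := by rw [funext hp]
    rw [deriv_comp_add_const, deriv.fun_neg, hc, hc] at h1
    linear_combination (1 / 2 : ℂ) * h1
  have h0 : ∀ z, deriv H z = 0 := fun z => by rw [hc, hc0]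
  have h1 := is_const_of_deriv_eq_zero hd h0 (a + 1) a
  rw [hp] at h1
  linear_combination (-1 / 2 : ℂ) * h1

/-- A function on a strip of width more than one that is antiperiodic where that makes sense and
of linear growth vanishes. -/
theorem eq_zero_of_antiperiodic_on_strip {h : ℂ → ℂ}
    (hd : DifferentiableOn ℂ h {a | 1 / 8 < a.re ∧ a.re < 11 / 8})
    (hp : ∀ a : ℂ, 1 / 8 < a.re → a.re < 3 / 8 → h (a + 1) = -h a) {K : ℝ}
    (hb : ∀ a : ℂ, 1 / 4 ≤ a.re → a.re ≤ 5 / 4 → ‖h a‖ ≤ K * (1 + |a.im|))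
    {a : ℂ} (h1 : 1 / 4 ≤ a.re) (h2 : a.re < 5 / 4) : h a = 0 := by
  -- The integer m(a) translates a into the fundamental domain 1/4 ≤ Re < 5/4.
  set m : ℂ → ℤ := fun a => ⌊a.re - 1 / 4⌋
  set H : ℂ → ℂ := fun a => (-1 : ℂ) ^ (m a) * h (a - m a)
  have hm : ∀ a, (m a : ℝ) ≤ a.re - 1 / 4 ∧ a.re - 1 / 4 < m a + 1 := fun a =>
    ⟨Int.floor_le _, Int.lt_floor_add_one _⟩
  -- On the overlaps antiperiodicity makes neighbouring translates agree, so one holomorphic formula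
  -- for H is valid on an open strip around every point.
  have key : ∀ (n : ℤ) (a : ℂ), (n : ℝ) + 1 / 8 < a.re → a.re < n + 11 / 8 →
      H a = (-1 : ℂ) ^ n * h (a - n) := by
    intro n a g1 g2
    obtain ⟨f1, f2⟩ := hm a
    have l1 : n - 2 < m a := by
      have : ((n - 2 : ℤ) : ℝ) < m a := by push_cast; linarith
      exact_mod_cast this
    have l2 : m a < n + 2 := by
      have : (m a : ℝ) < ((n + 2 : ℤ) : ℝ) := by push_cast; linarith
      exact_mod_cast this
    have : m a = n - 1 ∨ m a = n ∨ m a = n + 1 := by omega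
    rcases this with e | e | e
    · have e' : (m a : ℝ) = n - 1 := by rw [e]; push_cast; ring
      have := hp (a - n) (by simp; linarith) (by simp; linarith)
      simp only [H, e]
      rw [zpow_sub_one₀ (by norm_num), show a - ((n - 1 : ℤ) : ℂ) = a - n + 1 by push_cast; ring,
        this]
      norm_num
    · simp only [H, e]
    · have e' : (m a : ℝ) = n + 1 := by rw [e]; push_cast; ring
      have := hp (a - n - 1) (by simp; linarith) (by simp; linarith)
      simp only [H, e]
      rw [zpow_add_one₀ (by norm_num), show a - ((n + 1 : ℤ) : ℂ) = a - n - 1 by push_cast; ring]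
      rw [sub_add_cancel] at this
      rw [this]
      ring
  have hHd : Differentiable ℂ H := by
    intro a
    obtain ⟨f1, f2⟩ := hm a
    have hU := (isOpen_strip ((m a : ℝ) + 1 / 8) (m a + 11 / 8)).mem_nhds
      (x := a) ⟨by linarith, by linarith⟩
    have hev : H =ᶠ[𝓝 a] fun z => (-1 : ℂ) ^ (m a) * h (z - m a) := by
      filter_upwards [hU] with z hz using key _ z hz.1 hz.2
    refine (DifferentiableAt.const_mul ?_ _).congr_of_eventuallyEq hev
    have h3 : DifferentiableAt ℂ h (a - m a) := hd.differentiableAt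
      ((isOpen_strip _ _).mem_nhds ⟨by simp; linarith, by simp; linarith⟩)
    exact h3.comp a (f := fun z => z - (m a : ℂ)) (by fun_prop)
  have hHp : ∀ a, H (a + 1) = -H a := by
    intro a
    have e : m (a + 1) = m a + 1 := by
      simp only [m]
      rw [show (a + 1).re - 1 / 4 = a.re - 1 / 4 + 1 by simp; ring, Int.floor_add_one]
    simp only [H, e]
    rw [zpow_add_one₀ (by norm_num), show a + 1 - ((m a + 1 : ℤ) : ℂ) = a - m a by push_cast; ring]
    ring
  have hHb : ∀ a, ‖H a‖ ≤ K * (1 + |a.im|) := by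
    intro a
    obtain ⟨f1, f2⟩ := hm a
    have := hb (a - m a) (by simp; linarith) (by simp; linarith)
    simpa [H, norm_zpow] using this
  have h0 := eq_zero_of_antiperiodic_of_linear_growth hHd hHp hHb a
  rw [key 0 a (by push_cast; linarith) (by push_cast; linarith)] at h0
  simpa using h0

/-! ### Estimates for the cosine and for Gamma quotients -/

theorem cos_pi_mul_eq_zero_iff {a : ℂ} :
    Complex.cos (Real.pi * a) = 0 ↔ ∃ k : ℤ, a = k + 1 / 2 := by
  have hpi : (Real.pi : ℂ) ≠ 0 := by exact_mod_cast Real.pi_ne_zero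
  rw [Complex.cos_eq_zero_iff]
  refine exists_congr fun k => ?_
  constructor
  · intro h
    apply mul_left_cancel₀ hpi
    rw [h]
    ring
  · rintro rfl
    ring

theorem cos_pi_mul_add_one (a : ℂ) :
    Complex.cos (Real.pi * (a + 1)) = -Complex.cos (Real.pi * a) := by
  rw [mul_add, mul_one, Complex.cos_add_pi]

/-- The reverse triangle inequality for the two exponentials gives |cos z| ≥ sinh|Im z|. -/
theorem abs_im_le_norm_cos (z : ℂ) : |z.im| ≤ ‖Complex.cos z‖ := by
  have h1 : |z.im| ≤ Real.sinh |z.im| := Real.self_le_sinh_iff.2 (abs_nonneg _)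
  have h2 : Real.sinh |z.im| = |Real.exp z.im - Real.exp (-z.im)| / 2 := by
    rw [← Real.abs_sinh, Real.sinh_eq, abs_div, abs_two]
  refine h1.trans ?_
  rw [h2, Complex.cos, norm_div, Complex.norm_ofNat]
  gcongr
  have h3 := abs_norm_sub_norm_le (Complex.exp (-z * Complex.I)) (-Complex.exp (z * Complex.I))
  rw [norm_neg, Complex.norm_exp, Complex.norm_exp] at h3
  simp only [sub_neg_eq_add] at h3
  rw [add_comm]
  simpa using h3

/-- The quotient is B(a+s, 1-s)/Γ(1-s). For Re a ≥ 0 the factor x^a has modulus at most 1 on (0,1],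
so the Beta integral is dominated by its integrand at a = 0. -/
theorem norm_Gamma_ratio_le {s : ℝ} (h0 : 0 < s) (h1 : s < 1) :
    ∃ K : ℝ, 0 ≤ K ∧ ∀ a : ℂ, 0 ≤ a.re →
      ‖Complex.Gamma (a + s) / Complex.Gamma (a + 1)‖ ≤ K := by
  set g : ℝ → ℝ := fun x => ‖(x : ℂ) ^ ((s : ℂ) - 1) * (1 - (x : ℂ)) ^ ((1 - s : ℂ) - 1)‖
  have hg : IntervalIntegrable g MeasureTheory.volume 0 1 :=
    (Complex.betaIntegral_convergent (u := s) (v := 1 - s) (by simpa) (by simpa)).norm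
  have hgn : ‖Complex.Gamma (1 - s)‖ ≠ 0 :=
    norm_ne_zero_iff.2 (Complex.Gamma_ne_zero_of_re_pos (by simpa))
  refine ⟨(∫ x in (0 : ℝ)..1, g x) / ‖Complex.Gamma (1 - s)‖,
    div_nonneg (intervalIntegral.integral_nonneg zero_le_one fun _ _ => norm_nonneg _)
      (norm_nonneg _), fun a ha => ?_⟩
  have hB := Complex.Gamma_mul_Gamma_eq_betaIntegral (s := a + s) (t := 1 - s)
    (by simp; linarith) (by simpa)
  rw [show a + s + (1 - s) = a + 1 by ring] at hB
  have hG : Complex.Gamma (a + 1) ≠ 0 := Complex.Gamma_ne_zero_of_re_pos (by simp; linarith)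
  have e : Complex.Gamma (a + s) / Complex.Gamma (a + 1) * Complex.Gamma (1 - s) =
      Complex.betaIntegral (a + s) (1 - s) := by
    rw [div_mul_eq_mul_div, hB, mul_div_cancel_left₀ _ hG]
  rw [le_div_iff₀ (lt_of_le_of_ne (norm_nonneg _) hgn.symm), ← norm_mul, e,
    Complex.betaIntegral]
  refine intervalIntegral.norm_integral_le_of_norm_le zero_le_one ?_ hg
  refine Eventually.of_forall fun x hx => ?_
  simp only [g, norm_mul]
  gcongr
  rw [Complex.norm_cpow_eq_rpow_re_of_pos hx.1, Complex.norm_cpow_eq_rpow_re_of_pos hx.1]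
  exact Real.rpow_le_rpow_of_exponent_ge hx.1 hx.2 (by simpa)

/-! ### The Gamma weight -/

/-- The Gamma quotient in the second evaluation. -/
def gammaFactor (a : ℂ) : ℂ :=
  risingC 1 a ^ 3 / (risingC (1 / 2) a * risingC (1 / 6) a * risingC (5 / 6) a)

/-- The reciprocal of the gamma factor and the exponential factor in the second evaluation. -/
def gammaWeight (a : ℂ) : ℂ :=
  (27 : ℂ) ^ a / (512 : ℂ) ^ a *
    (risingC (1 / 2) a * risingC (1 / 6) a * risingC (5 / 6) a / risingC 1 a ^ 3)

theorem risingC_ne_zero {x a : ℂ} (hx : 0 < x.re) (ha : 0 < (x + a).re) : risingC x a ≠ 0 :=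
  div_ne_zero (Complex.Gamma_ne_zero_of_re_pos ha) (Complex.Gamma_ne_zero_of_re_pos hx)

theorem risingC_add_one {x a : ℂ} (h : x + a ≠ 0) : risingC x (a + 1) = (x + a) * risingC x a := by
  rw [risingC, risingC, ← add_assoc, Complex.Gamma_add_one _ h, mul_div_assoc]

/-- When x+a = 0, both sides vanish because Γ(0) is 0 by convention. This is the functional equation
of the entire function 1/Γ, valid without exceptions. -/
theorem inv_risingC (x a : ℂ) : (risingC x a)⁻¹ = (x + a) * (risingC x (a + 1))⁻¹ := by
  by_cases h : x + a = 0
  · rw [risingC, h, Complex.Gamma_zero]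
    simp
  · rw [risingC_add_one h, mul_inv, ← mul_assoc, mul_inv_cancel₀ h, one_mul]

theorem gammaFactor_shift {a : ℂ} (h : a + 1 ≠ 0) :
    (512 : ℂ) ^ a / (27 : ℂ) ^ a * gammaFactor a =
      -shiftRatio a * ((512 : ℂ) ^ (a + 1) / (27 : ℂ) ^ (a + 1) * gammaFactor (a + 1)) := by
  have h' : 1 + a ≠ 0 := by rwa [add_comm]
  have hc : (27 : ℂ) ^ a ≠ 0 := by simp [Complex.cpow_eq_zero_iff]
  simp only [gammaFactor, shiftRatio]
  rw [Complex.cpow_add _ _ (by norm_num), Complex.cpow_add _ _ (by norm_num), Complex.cpow_one,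
    Complex.cpow_one, risingC_add_one h', div_eq_mul_inv (risingC 1 a ^ 3), mul_inv, mul_inv,
    inv_risingC (1 / 2), inv_risingC (1 / 6), inv_risingC (5 / 6), add_comm a 1,
    add_comm a (1 / 2), add_comm a (1 / 6), add_comm a (5 / 6)]
  field_simp

theorem gammaWeight_mul {a : ℂ} (ha : 0 ≤ a.re) :
    gammaWeight a * ((512 : ℂ) ^ a / (27 : ℂ) ^ a * gammaFactor a) = 1 := by
  have c1 : (27 : ℂ) ^ a ≠ 0 := by simp [Complex.cpow_eq_zero_iff]
  have c2 : (512 : ℂ) ^ a ≠ 0 := by simp [Complex.cpow_eq_zero_iff]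
  have r1 : risingC 1 a ≠ 0 := risingC_ne_zero (by simp) (by simp; linarith)
  have r2 : risingC (1 / 2) a ≠ 0 := risingC_ne_zero (by simp) (by simp; linarith)
  have r3 : risingC (1 / 6) a ≠ 0 := risingC_ne_zero (by norm_num) (by norm_num; linarith)
  have r4 : risingC (5 / 6) a ≠ 0 := risingC_ne_zero (by norm_num) (by norm_num; linarith)
  rw [gammaWeight, gammaFactor]
  field_simp

theorem gammaWeight_shift {a : ℂ} (ha : 0 ≤ a.re) :
    gammaWeight (a + 1) = -shiftRatio a * gammaWeight a := by
  have h1 : a + 1 ≠ 0 := ne_zero_of_re_pos (by simp; linarith)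
  have e1 := gammaWeight_mul ha
  have e2 := gammaWeight_mul (a := a + 1) (by simp; linarith)
  have e3 := gammaFactor_shift h1
  rw [e3] at e1
  linear_combination (-shiftRatio a * gammaWeight a) * e2 - gammaWeight (a + 1) * e1

theorem differentiableAt_risingC {x a : ℂ} (ha : 0 < (x + a).re) :
    DifferentiableAt ℂ (risingC x) a := by
  have h : DifferentiableAt ℂ Complex.Gamma (x + a) :=
    Complex.differentiableAt_Gamma _ fun m hm => by
      rw [hm] at ha
      simp at ha
      have : (0 : ℝ) ≤ m := m.cast_nonneg
      linarith
  exact (h.comp a (f := fun a => x + a) (by fun_prop)).div_const _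

theorem differentiableAt_gammaWeight {a : ℂ} (ha : -1 / 8 < a.re) :
    DifferentiableAt ℂ gammaWeight a := by
  have r1 : risingC 1 a ≠ 0 := risingC_ne_zero (by simp) (by simp; linarith)
  have d1 : DifferentiableAt ℂ (risingC 1) a := differentiableAt_risingC (by simp; linarith)
  have d2 : DifferentiableAt ℂ (risingC (1 / 2)) a := differentiableAt_risingC (by simp; linarith)
  have d3 : DifferentiableAt ℂ (risingC (1 / 6)) a :=
    differentiableAt_risingC (by norm_num; linarith)
  have d4 : DifferentiableAt ℂ (risingC (5 / 6)) a :=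
    differentiableAt_risingC (by norm_num; linarith)
  have c2 : (512 : ℂ) ^ a ≠ 0 := by simp [Complex.cpow_eq_zero_iff]
  have dc : ∀ c : ℂ, c ≠ 0 → DifferentiableAt ℂ (fun a => c ^ a) a := fun c hc =>
    differentiableAt_id.const_cpow (Or.inl hc)
  exact ((dc 27 (by norm_num)).div (dc 512 (by norm_num)) c2).mul
    (((d2.mul d3).mul d4).div (d1.pow 3) (pow_ne_zero 3 r1))

/-- The weight is (27/512)^a times three quotients Γ(a+s)/Γ(a+1), each bounded by
`norm_Gamma_ratio_le`. -/
theorem exists_norm_gammaWeight_le :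
    ∃ K : ℝ, 0 ≤ K ∧ ∀ a : ℂ, 0 ≤ a.re → ‖gammaWeight a‖ ≤ K := by
  obtain ⟨K1, hK1, h1⟩ := norm_Gamma_ratio_le (s := 1 / 2) (by norm_num) (by norm_num)
  obtain ⟨K2, hK2, h2⟩ := norm_Gamma_ratio_le (s := 1 / 6) (by norm_num) (by norm_num)
  obtain ⟨K3, hK3, h3⟩ := norm_Gamma_ratio_le (s := 5 / 6) (by norm_num) (by norm_num)
  set C : ℂ := (Complex.Gamma (1 / 2) * Complex.Gamma (1 / 6) * Complex.Gamma (5 / 6))⁻¹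
  refine ⟨1 * (K1 * K2 * K3 * ‖C‖), by positivity, fun a ha => ?_⟩
  have e : gammaWeight a = (27 : ℂ) ^ a / (512 : ℂ) ^ a *
      (Complex.Gamma (a + (1 / 2 : ℝ)) / Complex.Gamma (a + 1) *
        (Complex.Gamma (a + (1 / 6 : ℝ)) / Complex.Gamma (a + 1)) *
        (Complex.Gamma (a + (5 / 6 : ℝ)) / Complex.Gamma (a + 1)) * C) := by
    simp only [gammaWeight, risingC, C, Complex.Gamma_one]
    push_cast
    rw [add_comm (1 / 2) a, add_comm (1 / 6) a, add_comm (5 / 6) a, add_comm 1 a]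
    simp only [div_eq_mul_inv, mul_inv, inv_one, mul_one, ← inv_pow]
    ring
  have q1 : ‖(27 : ℂ) ^ a / (512 : ℂ) ^ a‖ ≤ 1 := by
    have e1 : ‖(27 : ℂ) ^ a‖ = (27 : ℝ) ^ a.re := by
      simpa using Complex.norm_cpow_eq_rpow_re_of_pos (x := 27) (by norm_num) a
    have e2 : ‖(512 : ℂ) ^ a‖ = (512 : ℝ) ^ a.re := by
      simpa using Complex.norm_cpow_eq_rpow_re_of_pos (x := 512) (by norm_num) a
    rw [norm_div, e1, e2, div_le_one (by positivity)]
    exact Real.rpow_le_rpow (by norm_num) (by norm_num) ha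
  rw [e, norm_mul, norm_mul, norm_mul, norm_mul]
  have q2 := h1 a ha
  have q3 := h2 a ha
  have q4 := h3 a ha
  gcongr


/-- Reflection at 1/2, 1/6 and 1/3 evaluates all the Gamma products. This value and the next
determine the constant of the second formula. -/
theorem gammaWeight_half :
    gammaWeight (1 / 2) = (Real.sqrt 2 : ℂ) / (4 * (Real.pi : ℂ) ^ 2) := by
  have hpi : (Real.pi : ℂ) ≠ 0 := by exact_mod_cast Real.pi_ne_zero
  have c27 : (27 : ℂ) ^ (1 / 2 : ℂ) = 3 * (Real.sqrt 3 : ℂ) := by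
    have h : Real.sqrt 27 = 3 * Real.sqrt 3 := by
      rw [show (27 : ℝ) = 3 ^ 2 * 3 by norm_num, Real.sqrt_mul (by norm_num),
        Real.sqrt_sq (by norm_num)]
    rw [Real.sqrt_eq_rpow] at h
    have h2 := congrArg (fun x : ℝ => (x : ℂ)) h
    simp only [Complex.ofReal_cpow (show (0 : ℝ) ≤ 27 by norm_num)] at h2
    simpa using h2
  have c512 : (512 : ℂ) ^ (1 / 2 : ℂ) = 16 * (Real.sqrt 2 : ℂ) := by
    have h : Real.sqrt 512 = 16 * Real.sqrt 2 := by
      rw [show (512 : ℝ) = 16 ^ 2 * 2 by norm_num, Real.sqrt_mul (by norm_num),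
        Real.sqrt_sq (by norm_num)]
    rw [Real.sqrt_eq_rpow] at h
    have h2 := congrArg (fun x : ℝ => (x : ℂ)) h
    simp only [Complex.ofReal_cpow (show (0 : ℝ) ≤ 512 by norm_num)] at h2
    simpa using h2
  have s2 : (Real.sqrt 2 : ℂ) ^ 2 = 2 := by
    exact_mod_cast Real.sq_sqrt (show (0 : ℝ) ≤ 2 by norm_num)
  have s3 : (Real.sqrt 3 : ℂ) ^ 2 = 3 := by
    exact_mod_cast Real.sq_sqrt (show (0 : ℝ) ≤ 3 by norm_num)
  have s2n : (Real.sqrt 2 : ℂ) ≠ 0 := fun h => by simp [h] at s2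
  have s3n : (Real.sqrt 3 : ℂ) ≠ 0 := fun h => by simp [h] at s3
  have g6 : Complex.Gamma (1 / 6) * Complex.Gamma (5 / 6) = 2 * Real.pi := by
    have h := Complex.Gamma_mul_Gamma_one_sub (1 / 6)
    rw [show (1 : ℂ) - 1 / 6 = 5 / 6 by norm_num] at h
    rw [h, show (Real.pi : ℂ) * (1 / 6) = ((Real.pi / 6 : ℝ) : ℂ) by push_cast; ring,
      ← Complex.ofReal_sin, Real.sin_pi_div_six]
    push_cast
    field_simp
  have g3 : Complex.Gamma (2 / 3) * Complex.Gamma (4 / 3) =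
      2 * Real.pi / (3 * (Real.sqrt 3 : ℂ)) := by
    have h := Complex.Gamma_mul_Gamma_one_sub (1 / 3)
    rw [show (1 : ℂ) - 1 / 3 = 2 / 3 by norm_num] at h
    have h2 := Complex.Gamma_add_one (1 / 3) (by norm_num)
    rw [show (1 / 3 : ℂ) + 1 = 4 / 3 by norm_num] at h2
    rw [h2, mul_comm, mul_assoc, h,
      show (Real.pi : ℂ) * (1 / 3) = ((Real.pi / 3 : ℝ) : ℂ) by push_cast; ring,
      ← Complex.ofReal_sin, Real.sin_pi_div_three]
    push_cast
    field_simp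
  have g2 : Complex.Gamma (1 / 2) ^ 2 = Real.pi := by
    have h := Complex.Gamma_mul_Gamma_one_sub (1 / 2)
    rw [show (1 : ℂ) - 1 / 2 = 1 / 2 by norm_num,
      show (Real.pi : ℂ) * (1 / 2) = ((Real.pi / 2 : ℝ) : ℂ) by push_cast; ring,
      ← Complex.ofReal_sin, Real.sin_pi_div_two] at h
    rw [pow_two, h]
    simp
  have g32 : Complex.Gamma (3 / 2) = 1 / 2 * Complex.Gamma (1 / 2) := by
    rw [← Complex.Gamma_add_one (1 / 2) (by norm_num)]
    norm_num
  have n1 : Complex.Gamma (1 / 2) ≠ 0 := Complex.Gamma_ne_zero_of_re_pos (by norm_num)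
  have n2 : Complex.Gamma (1 / 6) ≠ 0 := Complex.Gamma_ne_zero_of_re_pos (by norm_num)
  have n3 : Complex.Gamma (5 / 6) ≠ 0 := Complex.Gamma_ne_zero_of_re_pos (by norm_num)
  have e : gammaWeight (1 / 2) = (27 : ℂ) ^ (1 / 2 : ℂ) / (512 : ℂ) ^ (1 / 2 : ℂ) *
      (Complex.Gamma (2 / 3) * Complex.Gamma (4 / 3) /
        (Complex.Gamma (1 / 6) * Complex.Gamma (5 / 6)) * (8 / (Complex.Gamma (1 / 2) ^ 2) ^ 2)) := by
    rw [gammaWeight, risingC, risingC, risingC, risingC,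
      show (1 / 2 : ℂ) + 1 / 2 = 1 by norm_num, show (1 / 6 : ℂ) + 1 / 2 = 2 / 3 by norm_num,
      show (5 / 6 : ℂ) + 1 / 2 = 4 / 3 by norm_num, show (1 : ℂ) + 1 / 2 = 3 / 2 by norm_num,
      g32, Complex.Gamma_one]
    field_simp
    ring
  rw [e, c27, c512, g3, g6, g2]
  field_simp
  linear_combination -s2 * 16

/-- At a = 1/2 the Pochhammer symbols cancel and a geometric series remains. -/
theorem tsum_secondTerm_half : ∑' n, secondTerm (1 / 2) n = 2 := by
  have h : ∀ n, secondTerm (1 / 2) n = (1 / 2) ^ n := by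
    intro n
    have r1 : rising 1 n ≠ 0 := rising_ne_zero (fun j => by
      rw [add_comm]; exact_mod_cast j.succ_ne_zero) n
    have r2 : rising 2 n ≠ 0 := rising_ne_zero (fun j => by
      rw [add_comm]; exact_mod_cast (j + 1).succ_ne_zero) n
    rw [secondTerm, show (1 / 2 : ℂ) + 1 / 2 = 1 by norm_num,
      show 3 * (1 / 2 : ℂ) + 1 / 2 = 2 by norm_num, show 2 * (1 / 2 : ℂ) + 1 = 2 by norm_num,
      show (3 / 2 : ℂ) - 1 / 2 = 1 by norm_num, mul_comm (rising 2 n), div_self (mul_ne_zero r1 r2),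
      mul_one, one_div_pow]
  rw [tsum_congr h, tsum_geometric_of_norm_lt_one (by norm_num)]
  norm_num

/-! ### Removing the pole at 1/2 -/

/-- The difference of `f` and the second hypergeometric series. -/
def secondDiff (a : ℂ) : ℂ :=
  ramanujanSeries a - 512 * a ^ 2 / (2 * a - 1) * ∑' n, secondTerm a n

/-- The constant in the second evaluation. -/
def secondConst : ℂ := 32 * (Real.sqrt 2 : ℂ) / (Real.pi : ℂ)

theorem secondDiff_shift {a : ℂ} (h1 : a + 1 ≠ 0) (h2 : ∀ k : ℕ, 2 * a + 1 + k ≠ 0)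
    (h3 : ∀ k : ℕ, 1 / 2 - a + k ≠ 0) :
    secondDiff a = shiftRatio a * secondDiff (a + 1) := by
  rw [secondDiff, secondDiff, tsum_secondTerm_shift h1 h2 h3, ramanujanSeries_eq_add a]
  ring

/-- `cos (π a) / (a - 1 / 2)`, continued analytically. -/
def cosSlope : ℂ → ℂ := dslope (fun a => Complex.cos (Real.pi * a)) (1 / 2)

theorem cos_pi_half : Complex.cos (Real.pi * (1 / 2)) = 0 :=
  cos_pi_mul_eq_zero_iff.2 ⟨0, by simp⟩

theorem mul_cosSlope (a : ℂ) : (a - 1 / 2) * cosSlope a = Complex.cos (Real.pi * a) := by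
  have h := sub_smul_dslope (fun a : ℂ => Complex.cos (Real.pi * a)) (1 / 2) a
  rwa [smul_eq_mul, cos_pi_half, sub_zero] at h

theorem cosSlope_half : cosSlope (1 / 2) = -Real.pi := by
  have h : HasDerivAt (fun a : ℂ => Complex.cos (Real.pi * a))
      (-Complex.sin (Real.pi * (1 / 2)) * (Real.pi * 1)) (1 / 2) :=
    ((hasDerivAt_id (1 / 2 : ℂ)).const_mul (Real.pi : ℂ)).ccos
  rw [cosSlope, dslope_same, h.deriv,
    show (Real.pi : ℂ) * (1 / 2) = ((Real.pi / 2 : ℝ) : ℂ) by push_cast; ring,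
    ← Complex.ofReal_sin, Real.sin_pi_div_two]
  simp

theorem differentiable_cosSlope : Differentiable ℂ cosSlope := by
  rw [← differentiableOn_univ]
  refine (Complex.differentiableOn_dslope univ_mem).2 ?_
  exact Differentiable.differentiableOn (by fun_prop)

theorem cos_ne_zero_of_strip {a : ℂ} (h1 : 1 / 8 < a.re) (h2 : a.re < 11 / 8) (h : a ≠ 1 / 2) :
    Complex.cos (Real.pi * a) ≠ 0 := by
  intro h0
  obtain ⟨k, rfl⟩ := cos_pi_mul_eq_zero_iff.1 h0
  have e : ((k : ℂ) + 1 / 2).re = k + 1 / 2 := by simp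
  rw [e] at h1 h2
  have l1 : -1 < k := by
    have : ((-1 : ℤ) : ℝ) < k := by push_cast; linarith
    exact_mod_cast this
  have l2 : k < 1 := by
    have : (k : ℝ) < ((1 : ℤ) : ℝ) := by push_cast; linarith
    exact_mod_cast this
  have : k = 0 := by omega
  subst this
  simp at h

theorem cosSlope_ne_zero {a : ℂ} (h1 : 1 / 8 < a.re) (h2 : a.re < 11 / 8) : cosSlope a ≠ 0 := by
  by_cases h : a = 1 / 2
  · rw [h, cosSlope_half]
    exact neg_ne_zero.2 (by exact_mod_cast Real.pi_ne_zero)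
  · intro h0
    apply cos_ne_zero_of_strip h1 h2 h
    rw [← mul_cosSlope, h0, mul_zero]

/-- `cos (π a)` times the weighted difference of `secondDiff` and its closed form, continued
analytically to `1 / 2`. -/
def cosDefect (a : ℂ) : ℂ :=
  Complex.cos (Real.pi * a) * gammaWeight a * ramanujanSeries a -
    256 * a ^ 2 * cosSlope a * gammaWeight a * (∑' n, secondTerm a n) - secondConst

/-- The residue computation that fixes 32√2/π: the first summand vanishes with the cosine and the
second contributes 64π · √2/(4π²) · 2. -/
theorem cosDefect_half : cosDefect (1 / 2) = 0 := by
  have hpi : (Real.pi : ℂ) ≠ 0 := by exact_mod_cast Real.pi_ne_zero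
  rw [cosDefect, cos_pi_half, cosSlope_half, gammaWeight_half, tsum_secondTerm_half, secondConst]
  field_simp
  ring

theorem cosDefect_eq {a : ℂ} (h : a ≠ 1 / 2) :
    cosDefect a = Complex.cos (Real.pi * a) * (gammaWeight a * secondDiff a) - secondConst := by
  have h2 : 2 * a - 1 ≠ 0 := fun h0 => h (by linear_combination (1 / 2 : ℂ) * h0)
  have e : (a - 1 / 2) * (512 * a ^ 2 / (2 * a - 1)) = 256 * a ^ 2 := by
    rw [← mul_div_assoc, div_eq_iff h2]
    ring
  rw [cosDefect, secondDiff, ← mul_cosSlope]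
  linear_combination cosSlope a * gammaWeight a * (∑' n, secondTerm a n) * e

theorem differentiableOn_cosDefect :
    DifferentiableOn ℂ cosDefect {a | 1 / 8 < a.re ∧ a.re < 11 / 8} := by
  intro a ha
  have d1 : DifferentiableAt ℂ ramanujanSeries a := differentiableOn_ramanujanSeries.differentiableAt
    ((isOpen_lt continuous_const Complex.continuous_re).mem_nhds
      (show (0 : ℝ) < a.re by linarith [ha.1]))
  have d2 : DifferentiableAt ℂ (fun a => ∑' n, secondTerm a n) a :=
    differentiableOn_tsum_secondTerm.differentiableAt
      ((isOpen_strip _ _).mem_nhds ⟨by linarith [ha.1], ha.2⟩)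
  have d3 : DifferentiableAt ℂ gammaWeight a := differentiableAt_gammaWeight (by linarith [ha.1])
  have d4 := differentiable_cosSlope a
  have d5 : DifferentiableAt ℂ (fun a : ℂ => Complex.cos (Real.pi * a)) a := by fun_prop
  have d6 : DifferentiableAt ℂ (fun a : ℂ => 256 * a ^ 2) a := by fun_prop
  exact (((d5.mul d3).mul d1).sub (((d6.mul d4).mul d3).mul d2)).sub_const _
    |>.differentiableWithinAt

/-- The weighted difference of `secondDiff` and its closed form, on the strip. -/
def defect (a : ℂ) : ℂ := dslope cosDefect (1 / 2) a / cosSlope a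

theorem defect_eq {a : ℂ} (h1 : 1 / 8 < a.re) (h2 : a.re < 11 / 8) (h : a ≠ 1 / 2) :
    defect a = gammaWeight a * secondDiff a - secondConst / Complex.cos (Real.pi * a) := by
  have hs : a - 1 / 2 ≠ 0 := sub_ne_zero.2 h
  have e := sub_smul_dslope cosDefect (1 / 2) a
  rw [cosDefect_half, sub_zero, smul_eq_mul, cosDefect_eq h] at e
  have hc := cos_ne_zero_of_strip h1 h2 h
  have hk := cosSlope_ne_zero h1 h2
  rw [defect, ← mul_div_mul_left _ _ hs, e, mul_cosSlope]
  field_simp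

theorem differentiableOn_defect :
    DifferentiableOn ℂ defect {a | 1 / 8 < a.re ∧ a.re < 11 / 8} := by
  refine DifferentiableOn.div ?_ differentiable_cosSlope.differentiableOn
    fun a ha => cosSlope_ne_zero ha.1 ha.2
  exact (Complex.differentiableOn_dslope ((isOpen_strip _ _).mem_nhds (by norm_num))).2
    differentiableOn_cosDefect

theorem ne_zero_of_cos {a : ℂ} (hc : Complex.cos (Real.pi * a) ≠ 0) (k : ℤ) :
    1 / 2 - a + k ≠ 0 := fun h =>
  hc (cos_pi_mul_eq_zero_iff.2 ⟨k, by linear_combination -h⟩)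

/-- A zero would be a = -(k+1)/2, a half-integer if k is even and a negative integer if k is odd. -/
theorem two_mul_add_one_ne_zero {a : ℂ} (ha : ∀ m : ℕ, a ≠ -((m : ℂ) + 1))
    (hc : Complex.cos (Real.pi * a) ≠ 0) (k : ℕ) : 2 * a + 1 + k ≠ 0 := by
  intro h
  rcases Nat.even_or_odd' k with ⟨c, rfl | rfl⟩
  · refine hc (cos_pi_mul_eq_zero_iff.2 ⟨-c - 1, ?_⟩)
    push_cast at *
    linear_combination (1 / 2 : ℂ) * h
  · refine ha c ?_
    push_cast at *
    linear_combination (1 / 2 : ℂ) * h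

theorem secondDiff_shift_of_cos {a : ℂ} (ha : ∀ m : ℕ, a ≠ -((m : ℂ) + 1))
    (hc : Complex.cos (Real.pi * a) ≠ 0) :
    secondDiff a = shiftRatio a * secondDiff (a + 1) :=
  secondDiff_shift (fun h => ha 0 (by push_cast; linear_combination h))
    (two_mul_add_one_ne_zero ha hc) fun k => by exact_mod_cast ne_zero_of_cos hc k

theorem ne_neg_of_re_pos {a : ℂ} (h : 0 < a.re) (m : ℕ) : a ≠ -((m : ℂ) + 1) := by
  rintro rfl
  have : (0 : ℝ) ≤ m := m.cast_nonneg
  simp at h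
  linarith

/-- The sign in the weight's shift turns the homogeneous recursion into antiperiodicity, matching
that of 1/cos(πa). -/
theorem defect_add_one {a : ℂ} (h1 : 1 / 8 < a.re) (h2 : a.re < 3 / 8) :
    defect (a + 1) = -defect a := by
  have n1 : a ≠ 1 / 2 := by
    rintro rfl
    norm_num at h2
  have n2 : a + 1 ≠ 1 / 2 := by
    intro h
    have := congrArg Complex.re h
    simp at this
    linarith
  have hc := cos_ne_zero_of_strip h1 (by linarith) n1
  rw [defect_eq (by simp; linarith) (by simp; linarith) n2, defect_eq h1 (by linarith) n1,
    cos_pi_mul_add_one, gammaWeight_shift (by linarith),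
    secondDiff_shift_of_cos (ne_neg_of_re_pos (by linarith)) hc, div_neg]
  ring

theorem exists_norm_defect_le : ∃ K : ℝ, ∀ a : ℂ, 1 / 4 ≤ a.re → a.re ≤ 5 / 4 →
    ‖defect a‖ ≤ K * (1 + |a.im|) := by
  obtain ⟨KW, hW0, hW⟩ := exists_norm_gammaWeight_le
  obtain ⟨KF, hF0, hF⟩ := exists_norm_ramanujanSeries_le
  obtain ⟨KS, hS0, hS⟩ := exists_norm_tsum_secondTerm_le
  have hcpt : IsCompact (Set.Icc (1 / 4 : ℝ) (5 / 4) ×ℂ Set.Icc (-1 : ℝ) 1) :=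
    isCompact_Icc.reProdIm isCompact_Icc
  obtain ⟨K0, hK0⟩ := hcpt.exists_bound_of_continuousOn (f := defect)
    (differentiableOn_defect.continuousOn.mono fun a ha => by
      have := ha.1
      simp only [Set.mem_preimage, Set.mem_Icc] at this
      exact ⟨by linarith, by linarith⟩)
  refine ⟨|K0| + (KW * (KF * 4 + 2304 * KS) + ‖secondConst‖), fun a h1 h2 => ?_⟩
  have hy0 : 0 ≤ |a.im| := abs_nonneg _
  -- For |Im a| ≤ 1 the explicit formula breaks down at 1/2, so continuity on a compact rectangle is
  -- used. For |Im a| > 1 it is bounded factor by factor, with |cos(πa)| ≥ 1.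
  rcases le_or_gt |a.im| 1 with hy | hy
  · have b1 := hK0 a ⟨⟨h1, h2⟩, abs_le.1 hy⟩
    have : 0 ≤ KW * (KF * 4 + 2304 * KS) + ‖secondConst‖ := by positivity
    have h3 := le_abs_self K0
    nlinarith [abs_nonneg K0]
  · have n1 : a ≠ 1 / 2 := by
      rintro rfl
      norm_num at hy
    rw [defect_eq (by linarith) (by linarith) n1]
    have b1 : ‖a‖ ≤ 3 * |a.im| := by
      have := Complex.norm_le_abs_re_add_abs_im a
      rw [abs_of_nonneg (show 0 ≤ a.re by linarith)] at this
      linarith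
    have b2 : 2 * |a.im| ≤ ‖2 * a - 1‖ := by
      have := Complex.abs_im_le_norm (2 * a - 1)
      simpa [abs_mul] using this
    have b3 : ‖512 * a ^ 2 / (2 * a - 1)‖ ≤ 2304 * |a.im| := by
      rw [norm_div, norm_mul, norm_pow, Complex.norm_ofNat, div_le_iff₀ (by linarith)]
      calc 512 * ‖a‖ ^ 2 ≤ 512 * (3 * |a.im|) ^ 2 := by gcongr
        _ = 2304 * |a.im| * (2 * |a.im|) := by ring
        _ ≤ _ := by gcongr
    have b4 : ‖secondDiff a‖ ≤ (KF * 4 + 2304 * KS) * (1 + |a.im|) := by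
      refine (norm_sub_le _ _).trans ?_
      rw [norm_mul]
      calc _ ≤ KF * (1 + 3 * |a.im|) + 2304 * |a.im| * KS := by
            have := hF a (by linarith)
            have := hS a (by linarith) (by linarith)
            gcongr
            exact (hF a (by linarith)).trans (by gcongr)
        _ ≤ _ := by
            have := mul_nonneg hF0 hy0
            nlinarith
    have b5 : 1 ≤ ‖Complex.cos (Real.pi * a)‖ := by
      refine le_trans ?_ (abs_im_le_norm_cos _)
      have : ((Real.pi : ℂ) * a).im = Real.pi * a.im := by simp
      rw [this, abs_mul, abs_of_pos Real.pi_pos]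
      nlinarith [Real.pi_gt_three]
    refine (norm_sub_le _ _).trans ?_
    rw [norm_mul, norm_div]
    have b6 : ‖secondConst‖ / ‖Complex.cos (Real.pi * a)‖ ≤ ‖secondConst‖ :=
      div_le_self (norm_nonneg _) b5
    have b7 : ‖gammaWeight a‖ * ‖secondDiff a‖ ≤
        KW * ((KF * 4 + 2304 * KS) * (1 + |a.im|)) := by
      have := hW a (by linarith)
      gcongr
    nlinarith [abs_nonneg K0, norm_nonneg secondConst, mul_nonneg (norm_nonneg secondConst) hy0,
      mul_nonneg (abs_nonneg K0) hy0]

theorem defect_eq_zero {a : ℂ} (h1 : 1 / 4 ≤ a.re) (h2 : a.re < 5 / 4) : defect a = 0 := by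
  obtain ⟨K, hK⟩ := exists_norm_defect_le
  exact eq_zero_of_antiperiodic_on_strip differentiableOn_defect
    (fun _ => defect_add_one) hK h1 h2

/-! ### The closed form and its extension beyond the strip -/

/-- The closed form of `secondDiff`. -/
def secondClosed (a : ℂ) : ℂ :=
  secondConst * ((512 : ℂ) ^ a / (27 : ℂ) ^ a * gammaFactor a) / Complex.cos (Real.pi * a)

theorem secondClosed_shift {a : ℂ} (h : a + 1 ≠ 0) :
    secondClosed a = shiftRatio a * secondClosed (a + 1) := by
  rw [secondClosed, secondClosed, gammaFactor_shift h, cos_pi_mul_add_one, div_neg]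
  ring

theorem secondDiff_eq_of_strip {a : ℂ} (h1 : 1 / 4 ≤ a.re) (h2 : a.re < 5 / 4)
    (hc : Complex.cos (Real.pi * a) ≠ 0) : secondDiff a = secondClosed a := by
  have n1 : a ≠ 1 / 2 := by
    rintro rfl
    exact hc cos_pi_half
  have h := defect_eq (by linarith) (by linarith) n1
  rw [defect_eq_zero h1 h2] at h
  have hw := gammaWeight_mul (a := a) (by linarith)
  set E := (512 : ℂ) ^ a / (27 : ℂ) ^ a * gammaFactor a with hE
  have h3 : gammaWeight a * secondDiff a = secondConst / Complex.cos (Real.pi * a) := by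
    linear_combination -h
  rw [secondClosed, ← hE]
  calc secondDiff a = (gammaWeight a * E) * secondDiff a := by rw [hw, one_mul]
    _ = E * (gammaWeight a * secondDiff a) := by ring
    _ = _ := by rw [h3]; ring

theorem cos_pi_mul_add_ne_zero {a : ℂ} (hc : Complex.cos (Real.pi * a) ≠ 0) (n : ℤ) :
    Complex.cos (Real.pi * (a + n)) ≠ 0 := by
  rw [Ne, cos_pi_mul_eq_zero_iff] at *
  rintro ⟨k, hk⟩
  exact hc ⟨k - n, by push_cast; linear_combination hk⟩

/-- Descent along the common recursion. Only its validity at each step is needed. -/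
theorem secondDiff_eq_of_add {a : ℂ} (n : ℕ) (ha : ∀ m : ℕ, a ≠ -((m : ℂ) + 1))
    (hc : Complex.cos (Real.pi * a) ≠ 0) (h : secondDiff (a + n) = secondClosed (a + n)) :
    secondDiff a = secondClosed a := by
  induction n with
  | zero => simpa using h
  | succ n ih =>
    apply ih
    have ha' : ∀ m : ℕ, a + n ≠ -((m : ℂ) + 1) := fun m hm => ha (n + m) (by
      push_cast
      linear_combination hm)
    have hc' : Complex.cos (Real.pi * (a + n)) ≠ 0 := by
      exact_mod_cast cos_pi_mul_add_ne_zero hc n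
    rw [secondDiff_shift_of_cos ha' hc',
      secondClosed_shift fun h0 => ha' 0 (by push_cast; linear_combination h0)]
    push_cast at h
    rw [add_assoc, h]

theorem shiftRatio_ne_zero {a : ℂ} (h : 0 < a.re) : shiftRatio a ≠ 0 := by
  have n1 : a + 1 / 2 ≠ 0 := ne_zero_of_re_pos (by simp; linarith)
  have n2 : a + 1 / 6 ≠ 0 := ne_zero_of_re_pos (by norm_num; linarith)
  have n3 : a + 5 / 6 ≠ 0 := ne_zero_of_re_pos (by norm_num; linarith)
  have n4 : a + 1 ≠ 0 := ne_zero_of_re_pos (by simp; linarith)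
  rw [shiftRatio]
  exact mul_ne_zero (by norm_num) (div_ne_zero (mul_ne_zero (mul_ne_zero n1 n2) n3)
    (pow_ne_zero 3 n4))

/-- Ascent divides by `shiftRatio`, which is nonzero for Re a > 0. -/
theorem secondDiff_add_eq {a : ℂ} (n : ℕ) (ha : 0 < a.re)
    (hc : Complex.cos (Real.pi * a) ≠ 0) (h : secondDiff a = secondClosed a) :
    secondDiff (a + n) = secondClosed (a + n) := by
  induction n with
  | zero => simpa using h
  | succ n ih =>
    have hre : 0 < (a + n).re := by simp; positivity
    have hc' : Complex.cos (Real.pi * (a + n)) ≠ 0 := by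
      exact_mod_cast cos_pi_mul_add_ne_zero hc n
    rw [secondDiff_shift_of_cos (ne_neg_of_re_pos hre) hc',
      secondClosed_shift (ne_zero_of_re_pos (by simp; positivity))] at ih
    have := mul_left_cancel₀ (shiftRatio_ne_zero hre) ih
    push_cast
    rwa [← add_assoc]

theorem secondDiff_eq {a : ℂ} (ha : ∀ m : ℕ, a ≠ -((m : ℂ) + 1))
    (hc : Complex.cos (Real.pi * a) ≠ 0) : secondDiff a = secondClosed a := by
  have f1 := Int.floor_le (a.re - 1 / 4)
  have f2 := Int.lt_floor_add_one (a.re - 1 / 4)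
  set m := ⌊a.re - 1 / 4⌋
  have base : secondDiff (a - m) = secondClosed (a - m) := by
    refine secondDiff_eq_of_strip (by simp; linarith) (by simp; linarith) ?_
    have := cos_pi_mul_add_ne_zero hc (-m)
    push_cast at this
    rwa [← sub_eq_add_neg] at this
  obtain ⟨n, hn | hn⟩ := m.eq_nat_or_neg
  · have hc' : Complex.cos (Real.pi * (a - m)) ≠ 0 := by
      have := cos_pi_mul_add_ne_zero hc (-m)
      push_cast at this
      rwa [← sub_eq_add_neg] at this
    have := secondDiff_add_eq n (a := a - m) (by simp; linarith) hc' base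
    rw [hn] at this
    simpa using this
  · refine secondDiff_eq_of_add n ha hc ?_
    rw [hn] at base
    simpa using base

/-! ### The triplication formula -/

theorem prod_range_three_mul (s : ℂ) (n : ℕ) :
    (∏ j ∈ Finset.range n, (s + j)) * (∏ j ∈ Finset.range n, (s + 1 / 3 + j)) *
      (∏ j ∈ Finset.range n, (s + 2 / 3 + j)) * 27 ^ n =
      ∏ j ∈ Finset.range (3 * n), (3 * s + j) := by
  induction n with
  | zero => simp
  | succ n ih =>
    rw [show 3 * (n + 1) = 3 * n + 1 + 1 + 1 by ring]
    simp only [Finset.prod_range_succ]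
    rw [← ih]
    push_cast
    ring

/-- The index 3n+2 makes the product for 3s run over 3(n+1) factors, which split by residue modulo
3. The first factor on the right is independent of s, and the exponential tends to 3^(-3s). -/
theorem GammaSeq_triple {s : ℂ} {n : ℕ} (hn : n ≠ 0) :
    Complex.GammaSeq s n * Complex.GammaSeq (s + 1 / 3) n * Complex.GammaSeq (s + 2 / 3) n =
      ((n : ℂ) * (n.factorial : ℂ) ^ 3 * 27 ^ (n + 1) / (3 * n + 2).factorial) *
        Complex.exp (3 * s * ((Real.log n - Real.log (3 * n + 2) : ℝ) : ℂ)) *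
          Complex.GammaSeq (3 * s) (3 * n + 2) := by
  have hn' : (n : ℂ) ≠ 0 := by exact_mod_cast hn
  have h2 : ((3 * n + 2 : ℕ) : ℂ) ≠ 0 := by exact_mod_cast (by omega : 3 * n + 2 ≠ 0)
  have hf : ((3 * n + 2).factorial : ℂ) ≠ 0 := by exact_mod_cast (Nat.factorial_ne_zero _)
  have hp : (n : ℂ) ^ s * (n : ℂ) ^ (s + 1 / 3) * (n : ℂ) ^ (s + 2 / 3) =
      n * Complex.exp (3 * s * ((Real.log n - Real.log (3 * n + 2) : ℝ) : ℂ)) *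
        ((3 * n + 2 : ℕ) : ℂ) ^ (3 * s) := by
    have e : ((Real.log (3 * n + 2) : ℝ) : ℂ) = Complex.log ((3 * n + 2 : ℕ) : ℂ) := by
      rw [← Complex.natCast_log]
      push_cast
      rfl
    rw [← Complex.cpow_add _ _ hn', ← Complex.cpow_add _ _ hn',
      show s + (s + 1 / 3) + (s + 2 / 3) = 1 + 3 * s by ring, Complex.cpow_add _ _ hn',
      Complex.cpow_one, Complex.cpow_def_of_ne_zero hn', Complex.cpow_def_of_ne_zero h2,
      mul_assoc, ← Complex.exp_add]
    congr 2
    rw [Complex.ofReal_sub, e, Complex.natCast_log]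
    ring
  simp only [Complex.GammaSeq]
  rw [show 3 * n + 2 + 1 = 3 * (n + 1) by ring, ← prod_range_three_mul]
  have := congrArg (fun z => z * ((n.factorial : ℂ) ^ 3 /
    ((∏ j ∈ Finset.range (n + 1), (s + j)) * (∏ j ∈ Finset.range (n + 1), (s + 1 / 3 + j)) *
      (∏ j ∈ Finset.range (n + 1), (s + 2 / 3 + j))))) hp
  refine Eq.trans ?_ (this.trans ?_)
  · simp only [div_eq_mul_inv, mul_inv]
    ring
  · generalize (∏ j ∈ Finset.range (n + 1), (s + (j : ℂ))) = p1
    generalize (∏ j ∈ Finset.range (n + 1), (s + 1 / 3 + (j : ℂ))) = p2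
    generalize (∏ j ∈ Finset.range (n + 1), (s + 2 / 3 + (j : ℂ))) = p3
    simp only [div_eq_mul_inv, mul_inv]
    have hf' := mul_inv_cancel₀ hf
    have h27 : (27 : ℂ) ^ (n + 1) * ((27 : ℂ) ^ (n + 1))⁻¹ = 1 := mul_inv_cancel₀ (pow_ne_zero _ (by norm_num))
    generalize ((27 : ℂ) ^ (n + 1))⁻¹ = i27 at *
    generalize (27 : ℂ) ^ (n + 1) = q27 at *
    generalize (((3 * n + 2).factorial : ℂ))⁻¹ = fi at *
    generalize ((3 * n + 2).factorial : ℂ) = f at *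
    generalize ((3 * n + 2 : ℕ) : ℂ) ^ (3 * s) = w
    generalize Complex.exp (3 * s * ((Real.log n - Real.log (3 * n + 2) : ℝ) : ℂ)) = e
    linear_combination -(n : ℂ) * e * w * (n.factorial : ℂ) ^ 3 * p1⁻¹ * p2⁻¹ * p3⁻¹ *
      (f * fi * h27 + hf')

/-- The triplication formula of the Gamma function, up to its constant. -/
theorem Gamma_triple (s t : ℂ) :
    Complex.Gamma s * Complex.Gamma (s + 1 / 3) * Complex.Gamma (s + 2 / 3) *
      (Complex.Gamma (3 * t) * Complex.exp (3 * t * -Real.log 3)) =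
    Complex.Gamma t * Complex.Gamma (t + 1 / 3) * Complex.Gamma (t + 2 / 3) *
      (Complex.Gamma (3 * s) * Complex.exp (3 * s * -Real.log 3)) := by
  have hl : Tendsto (fun n : ℕ => (Real.log n - Real.log (3 * n + 2))) atTop
      (𝓝 (-Real.log 3)) := by
    have h1 : Tendsto (fun n : ℕ => (n : ℝ)⁻¹) atTop (𝓝 0) := tendsto_inv_atTop_nhds_zero_nat
    have h2 : Tendsto (fun n : ℕ => 3 + 2 * (n : ℝ)⁻¹) atTop (𝓝 3) := by
      simpa using (h1.const_mul 2).const_add 3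
    have h3 := (h2.log (by norm_num)).neg
    refine h3.congr' ?_
    filter_upwards [eventually_gt_atTop 0] with n hn
    have hn' : (0 : ℝ) < n := by exact_mod_cast hn
    rw [← neg_sub, ← Real.log_div (by positivity) hn'.ne']
    congr 2
    field_simp
  have hlc := (Complex.continuous_ofReal.tendsto _).comp hl
  have he : ∀ s : ℂ, Tendsto (fun n : ℕ =>
      Complex.exp (3 * s * ((Real.log n - Real.log (3 * n + 2) : ℝ) : ℂ))) atTop
      (𝓝 (Complex.exp (3 * s * -Real.log 3))) := fun s => by
    have := (Complex.continuous_exp.tendsto _).comp (hlc.const_mul (3 * s))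
    simpa [Function.comp_def] using this
  have hG := Complex.GammaSeq_tendsto_Gamma
  have hsub : Tendsto (fun n : ℕ => 3 * n + 2) atTop atTop :=
    tendsto_atTop_mono (fun n => (by omega : n ≤ 3 * n + 2)) tendsto_id
  have hA := fun s => ((hG s).mul (hG (s + 1 / 3))).mul (hG (s + 2 / 3))
  have hB := fun s => ((hG (3 * s)).comp hsub).mul (he s)
  -- Comparing s with t cancels the factor independent of s, so its limit is never needed.
  refine tendsto_nhds_unique ((hA s).mul (hB t)) (((hA t).mul (hB s)).congr' ?_)
  filter_upwards [eventually_ne_atTop 0] with n hn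
  simp only [Function.comp]
  rw [GammaSeq_triple hn, GammaSeq_triple hn]
  ring

/-- Triplication at s = a+1/6 and t = 1/6, where 3s = 3a+1/2. It eliminates the Gamma values near
1/6 and 5/6. -/
theorem Gamma_triple_sixth (a : ℂ) :
    Complex.Gamma (1 / 2 + a) * Complex.Gamma (1 / 6 + a) * Complex.Gamma (5 / 6 + a) *
      (Complex.Gamma (1 / 2) * (27 : ℂ) ^ a) =
    Complex.Gamma (1 / 2) * Complex.Gamma (1 / 6) * Complex.Gamma (5 / 6) *
      Complex.Gamma (3 * a + 1 / 2) := by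
  have h := Gamma_triple (a + 1 / 6) (1 / 6)
  have e27 : (27 : ℂ) ^ a = Complex.exp (3 * a * Real.log 3) := by
    rw [Complex.cpow_def_of_ne_zero (by norm_num)]
    congr 1
    have h27 : Real.log 27 = 3 * Real.log 3 := by
      rw [show (27 : ℝ) = 3 ^ 3 by norm_num, Real.log_pow]
      norm_num
    have : Complex.log 27 = ((Real.log 27 : ℝ) : ℂ) := by
      rw [Complex.ofReal_log (by norm_num)]
      norm_num
    rw [this, h27]
    push_cast
    ring
  have e1 : Complex.exp (3 * (a + 1 / 6) * -Real.log 3) * (27 : ℂ) ^ a =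
      Complex.exp (3 * (1 / 6) * -Real.log 3) := by
    rw [e27, ← Complex.exp_add]
    congr 1
    ring
  rw [show a + 1 / 6 + 1 / 3 = 1 / 2 + a by ring, show a + 1 / 6 + 2 / 3 = 5 / 6 + a by ring,
    show (3 : ℂ) * (1 / 6) = 1 / 2 by norm_num, show (1 / 6 : ℂ) + 1 / 3 = 1 / 2 by norm_num,
    show (1 / 6 : ℂ) + 2 / 3 = 5 / 6 by norm_num, show 3 * (a + 1 / 6) = 3 * a + 1 / 2 by ring,
    add_comm a (1 / 6)] at h
  rw [show (3 : ℂ) * (1 / 6) = 1 / 2 by norm_num,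
    show 3 * (a + 1 / 6) = 3 * a + 1 / 2 by ring] at e1
  apply mul_right_cancel₀ (Complex.exp_ne_zero (1 / 2 * -Real.log 3))
  rw [← e1] at h ⊢
  linear_combination (27 : ℂ) ^ a * h

/-! ### The Gamma factor near 0 -/

/-- The Gamma and exponential factors of the second evaluation, after triplication. -/
def centralFactor (a : ℂ) : ℂ :=
  (512 : ℂ) ^ a * Complex.Gamma (1 + a) ^ 3 * Complex.Gamma (1 / 2) /
    (Complex.cos (Real.pi * a) * Complex.Gamma (3 * a + 1 / 2))

theorem secondClosed_eq_centralFactor {a : ℂ} (h1 : -1 / 8 < a.re) :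
    secondClosed a = secondConst * centralFactor a := by
  have n1 : Complex.Gamma (1 / 2) ≠ 0 := Complex.Gamma_ne_zero_of_re_pos (by norm_num)
  have n2 : Complex.Gamma (1 / 6) ≠ 0 := Complex.Gamma_ne_zero_of_re_pos (by norm_num)
  have n3 : Complex.Gamma (5 / 6) ≠ 0 := Complex.Gamma_ne_zero_of_re_pos (by norm_num)
  have m1 : Complex.Gamma (1 / 2 + a) ≠ 0 :=
    Complex.Gamma_ne_zero_of_re_pos (by norm_num; linarith)
  have m2 : Complex.Gamma (1 / 6 + a) ≠ 0 :=
    Complex.Gamma_ne_zero_of_re_pos (by norm_num; linarith)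
  have m3 : Complex.Gamma (5 / 6 + a) ≠ 0 :=
    Complex.Gamma_ne_zero_of_re_pos (by norm_num; linarith)
  have m4 : Complex.Gamma (3 * a + 1 / 2) ≠ 0 :=
    Complex.Gamma_ne_zero_of_re_pos (by norm_num; linarith)
  have c27 : (27 : ℂ) ^ a ≠ 0 := by simp [Complex.cpow_eq_zero_iff]
  have h := Gamma_triple_sixth a
  have e : (512 : ℂ) ^ a / (27 : ℂ) ^ a * gammaFactor a =
      (512 : ℂ) ^ a * Complex.Gamma (1 + a) ^ 3 * Complex.Gamma (1 / 2) /
        Complex.Gamma (3 * a + 1 / 2) := by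
    rw [gammaFactor, risingC, risingC, risingC, risingC, Complex.Gamma_one, div_one]
    generalize Complex.Gamma (1 / 2 + a) = g1 at *
    generalize Complex.Gamma (1 / 6 + a) = g2 at *
    generalize Complex.Gamma (5 / 6 + a) = g3 at *
    generalize Complex.Gamma (3 * a + 1 / 2) = g4 at *
    generalize Complex.Gamma (1 / 2) = g5 at *
    generalize Complex.Gamma (1 / 6) = g6 at *
    generalize Complex.Gamma (5 / 6) = g7 at *
    generalize (27 : ℂ) ^ a = w at *
    have h' : g1 * g2 * g3 * w = g6 * g7 * g4 := mul_left_cancel₀ n1 (by linear_combination h)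
    field_simp
    linear_combination -Complex.Gamma (1 + a) ^ 3 * h'
  rw [secondClosed, e, centralFactor]
  simp only [div_eq_mul_inv, mul_inv]
  ring

theorem centralFactor_zero : centralFactor 0 = 1 := by
  have n1 : Complex.Gamma (1 / 2) ≠ 0 := Complex.Gamma_ne_zero_of_re_pos (by norm_num)
  rw [centralFactor]
  simp only [mul_zero, add_zero, zero_add, Complex.cpow_zero, Complex.Gamma_one, Complex.cos_zero,
    one_pow, one_mul]
  exact div_self n1

/-- The logarithmic derivative is 9 ln 2 - 3γ + 3(γ + 2 ln 2): Euler's constant cancels. -/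
theorem hasDerivAt_centralFactor :
    HasDerivAt centralFactor (15 * (Real.log 2 : ℂ)) 0 := by
  have hpi : (Real.sqrt Real.pi : ℂ) ≠ 0 := by
    exact_mod_cast (Real.sqrt_pos.2 Real.pi_pos).ne'
  have g : Complex.Gamma (1 / 2) = (Real.sqrt Real.pi : ℂ) := by
    rw [Complex.Gamma_one_half_eq, Real.sqrt_eq_rpow, Complex.ofReal_cpow Real.pi_nonneg]
    norm_num
  have d1 : HasDerivAt (fun a : ℂ => (512 : ℂ) ^ a) (9 * (Real.log 2 : ℂ)) 0 := by
    have h := (hasDerivAt_id (0 : ℂ)).const_cpow (c := 512) (Or.inl (by norm_num))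
    have h512 : Real.log 512 = 9 * Real.log 2 := by
      rw [show (512 : ℝ) = 2 ^ 9 by norm_num, Real.log_pow]
      norm_num
    have e : Complex.log 512 = ((Real.log 512 : ℝ) : ℂ) := by
      rw [Complex.ofReal_log (by norm_num)]
      norm_num
    rw [e, h512] at h
    refine h.congr_deriv ?_
    rw [id, Complex.cpow_zero]
    push_cast
    ring
  have d2 : HasDerivAt (fun a : ℂ => Complex.Gamma (1 + a))
      (-(Real.eulerMascheroniConstant : ℂ)) 0 := by
    have h : HasDerivAt Complex.Gamma (-(Real.eulerMascheroniConstant : ℂ)) (1 + 0) := by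
      rw [add_zero]
      exact Complex.hasDerivAt_Gamma_one
    exact h.comp_const_add 1 0
  have d3 : HasDerivAt (fun a : ℂ => Complex.Gamma (3 * a + 1 / 2))
      (-(Real.sqrt Real.pi : ℂ) * (Real.eulerMascheroniConstant + 2 * (Real.log 2 : ℂ)) * 3) 0 := by
    have h := Complex.hasDerivAt_Gamma_one_half
    have hl : Complex.log 2 = ((Real.log 2 : ℝ) : ℂ) := by
      rw [Complex.ofReal_log (by norm_num)]
      norm_num
    rw [hl] at h
    have e : (3 : ℂ) * 0 + 1 / 2 = 1 / 2 := by norm_num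
    rw [← e] at h
    have h2 : HasDerivAt (fun a : ℂ => 3 * a + 1 / 2) 3 0 := by
      simpa using ((hasDerivAt_id (0 : ℂ)).const_mul 3).add_const (1 / 2 : ℂ)
    exact HasDerivAt.comp (0 : ℂ) h h2
  have d4 : HasDerivAt (fun a : ℂ => Complex.cos (Real.pi * a)) 0 0 := by
    have := ((hasDerivAt_id (0 : ℂ)).const_mul (Real.pi : ℂ)).ccos
    simpa using this
  have hden : Complex.cos (Real.pi * 0) * Complex.Gamma (3 * 0 + 1 / 2) ≠ 0 := by
    simp only [mul_zero, Complex.cos_zero, zero_add, one_mul, g]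
    exact hpi
  have h := ((d1.fun_mul (d2.fun_pow 3)).mul_const (Complex.Gamma (1 / 2))).fun_div
    (d4.fun_mul d3) hden
  refine h.congr_deriv ?_
  simp only [mul_zero, Complex.cos_zero, zero_add, add_zero, one_mul, g, Complex.cpow_zero,
    Complex.Gamma_one, one_pow, zero_mul]
  field_simp
  push_cast
  ring

/-- `Γ(1 + a) Γ(1 - a)`. -/
def gammaReflection (a : ℂ) : ℂ := Complex.Gamma (1 + a) * Complex.Gamma (1 - a)

theorem analyticAt_Gamma {a : ℂ} (h : 0 < a.re) : AnalyticAt ℂ Complex.Gamma a := by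
  have : DifferentiableOn ℂ Complex.Gamma {z | 0 < z.re} := fun z hz =>
    (Complex.differentiableAt_Gamma _ fun m hm => by
      have hz' : 0 < z.re := hz
      rw [hm] at hz'
      simp at hz'
      have : (0 : ℝ) ≤ m := m.cast_nonneg
      linarith).differentiableWithinAt
  exact this.analyticAt ((isOpen_lt continuous_const Complex.continuous_re).mem_nhds h)

theorem analyticAt_gammaReflection : AnalyticAt ℂ gammaReflection 0 := by
  have h1 : AnalyticAt ℂ (fun a : ℂ => Complex.Gamma (1 + a)) 0 :=
    (analyticAt_Gamma (a := 1 + 0) (by simp)).comp (f := fun a : ℂ => 1 + a) (by fun_prop)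
  have h2 : AnalyticAt ℂ (fun a : ℂ => Complex.Gamma (1 - a)) 0 :=
    (analyticAt_Gamma (a := 1 - 0) (by simp)).comp (f := fun a : ℂ => 1 - a) (by fun_prop)
  exact h1.mul h2

theorem analyticAt_centralFactor : AnalyticAt ℂ centralFactor 0 := by
  have h1 : AnalyticAt ℂ (fun a : ℂ => Complex.Gamma (1 + a)) 0 :=
    (analyticAt_Gamma (a := 1 + 0) (by simp)).comp (f := fun a : ℂ => 1 + a) (by fun_prop)
  have h2 : AnalyticAt ℂ (fun a : ℂ => Complex.Gamma (3 * a + 1 / 2)) 0 :=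
    (analyticAt_Gamma (a := 3 * 0 + 1 / 2) (by simp)).comp (f := fun a : ℂ => 3 * a + 1 / 2) (by fun_prop)
  have h3 : AnalyticAt ℂ (fun a : ℂ => (512 : ℂ) ^ a) 0 := by
    have : Differentiable ℂ (fun a : ℂ => (512 : ℂ) ^ a) := fun a =>
      differentiableAt_id.const_cpow (Or.inl (by norm_num))
    exact this.analyticAt 0
  have h4 : AnalyticAt ℂ (fun a : ℂ => Complex.cos (Real.pi * a)) 0 := by fun_prop
  refine ((h3.mul (h1.pow 3)).mul analyticAt_const).div (h4.mul h2) ?_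
  simp only [mul_zero, Complex.cos_zero, zero_add, one_mul]
  exact Complex.Gamma_ne_zero_of_re_pos (by norm_num)

theorem eventually_re_lt {r : ℝ} (hr : 0 < r) : ∀ᶠ a : ℂ in 𝓝 0, |a.re| < r := by
  filter_upwards [Metric.ball_mem_nhds (0 : ℂ) hr] with a ha
  exact (Complex.abs_re_le_norm a).trans_lt (by simpa using ha)

theorem gammaReflection_mul_sin :
    ∀ᶠ a in 𝓝 0, gammaReflection a * Complex.sin (Real.pi * a) = Real.pi * a := by
  have hpi : (Real.pi : ℂ) ≠ 0 := by exact_mod_cast Real.pi_ne_zero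
  filter_upwards [eventually_re_lt (r := 1) one_pos] with a ha
  by_cases h0 : a = 0
  · simp [h0]
  · have hs : Complex.sin (Real.pi * a) ≠ 0 := by
      intro h
      obtain ⟨k, hk⟩ := Complex.sin_eq_zero_iff.1 h
      have hk' : a = k := mul_left_cancel₀ hpi (by rw [hk]; ring)
      rw [hk'] at ha h0
      simp only [Complex.intCast_re] at ha
      have hlt : |k| < 1 := by exact_mod_cast ha
      exact h0 (by rw [Int.abs_lt_one_iff.1 hlt]; simp)
    have h := Complex.Gamma_mul_Gamma_one_sub a
    rw [eq_div_iff hs] at h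
    rw [gammaReflection, add_comm, Complex.Gamma_add_one a h0]
    linear_combination a * h

theorem cos_ne_zero_of_re_mem {a : ℂ} (h1 : -1 / 2 < a.re) (h2 : a.re < 1 / 2) :
    Complex.cos (Real.pi * a) ≠ 0 := by
  intro h0
  obtain ⟨k, rfl⟩ := cos_pi_mul_eq_zero_iff.1 h0
  have e : ((k : ℂ) + 1 / 2).re = k + 1 / 2 := by simp
  rw [e] at h1 h2
  have l1 : -1 < k := by
    have : ((-1 : ℤ) : ℝ) < k := by push_cast; linarith
    exact_mod_cast this
  have l2 : k < 0 := by
    have : (k : ℝ) < ((0 : ℤ) : ℝ) := by push_cast; linarith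
    exact_mod_cast this
  omega

/-- Reflection evaluates the even product: Γ(1/2+3a)Γ(1/2-3a) = π/cos(3πa), and the powers of 512
cancel. It gives the second derivative at 0 without any second derivative of Γ. -/
theorem centralFactor_mul_neg : ∀ᶠ a in 𝓝 0,
    centralFactor a * centralFactor (-a) *
        (Complex.cos (Real.pi * a) * Complex.cos (Real.pi * a)) =
      gammaReflection a * (gammaReflection a * gammaReflection a) *
        Complex.cos (3 * Real.pi * a) := by
  have hpi : (Real.pi : ℂ) ≠ 0 := by exact_mod_cast Real.pi_ne_zero
  have n1 : Complex.Gamma (1 / 2) ^ 2 = Real.pi := by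
    have h := Complex.Gamma_mul_Gamma_one_sub (1 / 2)
    rw [show (1 : ℂ) - 1 / 2 = 1 / 2 by norm_num,
      show (Real.pi : ℂ) * (1 / 2) = ((Real.pi / 2 : ℝ) : ℂ) by push_cast; ring,
      ← Complex.ofReal_sin, Real.sin_pi_div_two] at h
    rw [pow_two, h]
    simp
  filter_upwards [eventually_re_lt (r := 1 / 8) (by norm_num)] with a ha
  rw [abs_lt] at ha
  have m1 : Complex.Gamma (3 * a + 1 / 2) ≠ 0 :=
    Complex.Gamma_ne_zero_of_re_pos (by norm_num; linarith)
  have m2 : Complex.Gamma (3 * -a + 1 / 2) ≠ 0 :=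
    Complex.Gamma_ne_zero_of_re_pos (by norm_num; linarith)
  have hc : Complex.cos (Real.pi * a) ≠ 0 :=
    cos_ne_zero_of_re_mem (by linarith) (by linarith)
  have hr : Complex.Gamma (3 * a + 1 / 2) * Complex.Gamma (3 * -a + 1 / 2) *
      Complex.cos (3 * Real.pi * a) = Real.pi := by
    have h := Complex.Gamma_mul_Gamma_one_sub (3 * a + 1 / 2)
    rw [show 1 - (3 * a + 1 / 2) = 3 * -a + 1 / 2 by ring,
      show (Real.pi : ℂ) * (3 * a + 1 / 2) = 3 * Real.pi * a + Real.pi / 2 by ring,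
      Complex.sin_add_pi_div_two] at h
    have hc3 : Complex.cos (3 * Real.pi * a) ≠ 0 := by
      intro h0
      rw [h0, div_zero] at h
      exact mul_ne_zero m1 m2 h
    rw [h, div_mul_cancel₀ _ hc3]
  have hw : (512 : ℂ) ^ a * (512 : ℂ) ^ (-a) = 1 := by
    rw [← Complex.cpow_add _ _ (by norm_num), add_neg_cancel, Complex.cpow_zero]
  rw [centralFactor, centralFactor, gammaReflection, ← sub_eq_add_neg 1 a, mul_neg,
    Complex.cos_neg]
  generalize Complex.Gamma (3 * a + 1 / 2) = g1 at *
  generalize Complex.Gamma (3 * -a + 1 / 2) = g2 at *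
  generalize Complex.Gamma (1 + a) = g3 at *
  generalize Complex.Gamma (1 - a) = g4 at *
  generalize Complex.Gamma (1 / 2) = g5 at *
  generalize Complex.cos (3 * Real.pi * a) = c3 at *
  generalize Complex.cos (Real.pi * a) = c1 at *
  generalize (512 : ℂ) ^ a = w1 at *
  generalize (512 : ℂ) ^ (-a) = w2 at *
  field_simp
  linear_combination g3 ^ 3 * g4 ^ 3 * (g5 ^ 2 * hw + n1 - hr)


/-! ### Second-order jets at 0 -/

/-- `F` is analytic at `0` with the given value and first two derivatives there. -/
def HasJet (F : ℂ → ℂ) (c₀ c₁ c₂ : ℂ) : Prop :=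
  AnalyticAt ℂ F 0 ∧ F 0 = c₀ ∧ deriv F 0 = c₁ ∧ deriv (deriv F) 0 = c₂

theorem HasJet.congr {F G : ℂ → ℂ} {c₀ c₁ c₂ : ℂ} (h : HasJet F c₀ c₁ c₂) (e : G =ᶠ[𝓝 0] F) :
    HasJet G c₀ c₁ c₂ :=
  ⟨h.1.congr e.symm, e.eq_of_nhds.trans h.2.1, e.deriv_eq.trans h.2.2.1,
    e.deriv.deriv_eq.trans h.2.2.2⟩

theorem HasJet.mul {F G : ℂ → ℂ} {c₀ c₁ c₂ d₀ d₁ d₂ : ℂ} (hF : HasJet F c₀ c₁ c₂)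
    (hG : HasJet G d₀ d₁ d₂) : HasJet (fun a => F a * G a) (c₀ * d₀) (c₁ * d₀ + c₀ * d₁)
      (c₂ * d₀ + 2 * (c₁ * d₁) + c₀ * d₂) := by
  obtain ⟨hF, rfl, rfl, rfl⟩ := hF
  obtain ⟨hG, rfl, rfl, rfl⟩ := hG
  refine ⟨hF.mul hG, rfl, deriv_fun_mul hF.differentiableAt hG.differentiableAt, ?_⟩
  have h : deriv (fun a => F a * G a) =ᶠ[𝓝 0] fun a => deriv F a * G a + F a * deriv G a := by
    filter_upwards [hF.eventually_analyticAt, hG.eventually_analyticAt] with a h1 h2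
    exact deriv_fun_mul h1.differentiableAt h2.differentiableAt
  have d1 := (hF.deriv.differentiableAt.hasDerivAt.fun_mul hG.differentiableAt.hasDerivAt).fun_add
    (hF.differentiableAt.hasDerivAt.fun_mul hG.deriv.differentiableAt.hasDerivAt)
  rw [h.deriv_eq, d1.deriv]
  ring

theorem HasJet.add {F G : ℂ → ℂ} {c₀ c₁ c₂ d₀ d₁ d₂ : ℂ} (hF : HasJet F c₀ c₁ c₂)
    (hG : HasJet G d₀ d₁ d₂) : HasJet (fun a => F a + G a) (c₀ + d₀) (c₁ + d₁) (c₂ + d₂) := by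
  obtain ⟨hF, rfl, rfl, rfl⟩ := hF
  obtain ⟨hG, rfl, rfl, rfl⟩ := hG
  refine ⟨hF.add hG, rfl, deriv_fun_add hF.differentiableAt hG.differentiableAt, ?_⟩
  have h : deriv (fun a => F a + G a) =ᶠ[𝓝 0] fun a => deriv F a + deriv G a := by
    filter_upwards [hF.eventually_analyticAt, hG.eventually_analyticAt] with a h1 h2
    exact deriv_fun_add h1.differentiableAt h2.differentiableAt
  rw [h.deriv_eq, deriv_fun_add hF.deriv.differentiableAt hG.deriv.differentiableAt]

theorem hasJet_const (c : ℂ) : HasJet (fun _ => c) c 0 0 :=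
  ⟨analyticAt_const, rfl, by simp, by simp⟩

theorem hasJet_id : HasJet (fun a => a) 0 1 0 :=
  ⟨analyticAt_id, rfl, by simp, by simp⟩

theorem HasJet.comp_neg {F : ℂ → ℂ} {c₀ c₁ c₂ : ℂ} (h : HasJet F c₀ c₁ c₂) :
    HasJet (fun a => F (-a)) c₀ (-c₁) c₂ := by
  obtain ⟨hF, rfl, rfl, rfl⟩ := h
  have e : deriv (fun a => F (-a)) = fun a => -deriv F (-a) := funext fun a => deriv_comp_neg F a
  refine ⟨?_, by simp, by rw [e]; simp, ?_⟩
  · have h' : AnalyticAt ℂ F (-0) := by rwa [neg_zero]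
    exact h'.comp (f := fun a : ℂ => -a) (by fun_prop)
  · rw [e, deriv.fun_neg, deriv_comp_neg]
    simp

theorem deriv_cos_mul (c : ℂ) :
    deriv (fun a => Complex.cos (c * a)) = fun a => -Complex.sin (c * a) * c := funext fun a => by
  have := ((hasDerivAt_id a).const_mul c).ccos
  simpa using this.deriv

theorem deriv_sin_mul (c : ℂ) :
    deriv (fun a => Complex.sin (c * a)) = fun a => Complex.cos (c * a) * c := funext fun a => by
  have := ((hasDerivAt_id a).const_mul c).csin
  simpa using this.deriv

theorem hasJet_cos (c : ℂ) : HasJet (fun a => Complex.cos (c * a)) 1 0 (-c ^ 2) := by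
  refine ⟨by fun_prop, by simp, by rw [deriv_cos_mul]; simp, ?_⟩
  rw [deriv_cos_mul, deriv_mul_const (by fun_prop), deriv.fun_neg, deriv_sin_mul]
  simp
  ring

theorem hasJet_sin (c : ℂ) : HasJet (fun a => Complex.sin (c * a)) 0 c 0 := by
  refine ⟨by fun_prop, by simp, by rw [deriv_sin_mul]; simp, ?_⟩
  rw [deriv_sin_mul, deriv_mul_const (by fun_prop), deriv_cos_mul]
  simp

theorem hasJet_gammaReflection : HasJet gammaReflection 1 0 ((Real.pi : ℂ) ^ 2 / 3) := by
  have hpi : (Real.pi : ℂ) ≠ 0 := by exact_mod_cast Real.pi_ne_zero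
  have h0 : gammaReflection 0 = 1 := by simp [gammaReflection]
  have hB : HasJet gammaReflection 1 (deriv gammaReflection 0) (deriv (deriv gammaReflection) 0) :=
    ⟨analyticAt_gammaReflection, h0, rfl, rfl⟩
  have h1 : deriv gammaReflection 0 = 0 := by
    have he : (fun a => gammaReflection (-a)) = gammaReflection := funext fun a => by
      simp only [gammaReflection, sub_neg_eq_add, ← sub_eq_add_neg]
      ring
    have h2 := hB.comp_neg.2.2.1
    rw [he] at h2
    linear_combination (1 / 2 : ℂ) * h2
  rw [h1] at hB
  have hB' : HasJet (deriv gammaReflection) 0 (deriv (deriv gammaReflection) 0)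
      (deriv (deriv (deriv gammaReflection)) 0) := ⟨analyticAt_gammaReflection.deriv, h1, rfl, rfl⟩
  have hs := hasJet_sin Real.pi
  have hs' := (hasJet_cos Real.pi).mul (hasJet_const Real.pi)
  have hsum := (hB'.mul hs).add (hB.mul hs')
  -- Differentiating B(a) sin(πa) = πa once gives a constant function. Its second derivative at 0
  -- reads 3πB'' - π³ = 0, using B'(0) = 0 by evenness.
  have hconst : (fun _ => (Real.pi : ℂ)) =ᶠ[𝓝 0] fun a =>
      deriv gammaReflection a * Complex.sin (Real.pi * a) +
        gammaReflection a * (Complex.cos (Real.pi * a) * Real.pi) := by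
    have e : (fun a => gammaReflection a * Complex.sin (Real.pi * a)) =ᶠ[𝓝 0]
      fun a => (Real.pi : ℂ) * a := gammaReflection_mul_sin
    filter_upwards [e.deriv, analyticAt_gammaReflection.eventually_analyticAt] with a h2 h3
    rw [deriv_fun_mul h3.differentiableAt (by fun_prop), deriv_sin_mul,
      deriv_const_mul _ differentiableAt_fun_id] at h2
    rw [h2]
    simp
  have h3 := (hsum.congr hconst).2.2.2
  simp only [deriv_const'] at h3
  refine ⟨hB.1, h0, h1, ?_⟩
  apply mul_left_cancel₀ hpi
  linear_combination (-1 / 3 : ℂ) * h3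

theorem hasJet_centralFactor : HasJet centralFactor 1 (15 * (Real.log 2 : ℂ))
    (225 * (Real.log 2 : ℂ) ^ 2 - 3 * (Real.pi : ℂ) ^ 2) := by
  have hX : HasJet centralFactor 1 (15 * (Real.log 2 : ℂ)) (deriv (deriv centralFactor) 0) :=
    ⟨analyticAt_centralFactor, centralFactor_zero, hasDerivAt_centralFactor.deriv, rfl⟩
  have hc := hasJet_cos Real.pi
  have hB := hasJet_gammaReflection
  have hl := (hX.mul hX.comp_neg).mul (hc.mul hc)
  have hr := (hB.mul (hB.mul hB)).mul (hasJet_cos (3 * Real.pi))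
  have h := (hr.congr centralFactor_mul_neg).2.2.2
  rw [hl.2.2.2] at h
  refine ⟨hX.1, hX.2.1, hX.2.2.1, ?_⟩
  -- With X the central factor, the second-order coefficients give 2X'' - 2X'² - 2π² = π² - 9π².
  linear_combination (1 / 2 : ℂ) * h

/-! ### The arcsine series and the second series at a = 0 -/

/-- The coefficients `(1/2)_n / n!` of the binomial series of exponent `-1/2`. -/
def halfCoeff (n : ℕ) : ℝ := Ring.choose ((1 / 2 : ℝ) + n - 1) n

theorem factorial_mul_halfCoeff (n : ℕ) :
    (n.factorial : ℝ) * halfCoeff n = (ascPochhammer ℝ n).eval (1 / 2) := by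
  have h := Ring.factorial_nsmul_multichoose_eq_ascPochhammer (1 / 2 : ℝ) n
  rw [Ring.multichoose_eq, nsmul_eq_mul, Polynomial.ascPochhammer_smeval_eq_eval] at h
  exact h

theorem halfCoeff_zero : halfCoeff 0 = 1 := by
  simpa using factorial_mul_halfCoeff 0

theorem halfCoeff_succ (n : ℕ) : halfCoeff (n + 1) = (n + 1 / 2) / (n + 1) * halfCoeff n := by
  have h1 := factorial_mul_halfCoeff n
  have h2 := factorial_mul_halfCoeff (n + 1)
  rw [ascPochhammer_succ_eval, ← h1, Nat.factorial_succ] at h2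
  have hf : (n.factorial : ℝ) ≠ 0 := by exact_mod_cast n.factorial_ne_zero
  have hn : (n : ℝ) + 1 ≠ 0 := by positivity
  push_cast at h2
  rw [div_mul_eq_mul_div, eq_div_iff hn]
  apply mul_left_cancel₀ hf
  linear_combination h2

theorem halfCoeff_mem (n : ℕ) : 0 ≤ halfCoeff n ∧ halfCoeff n ≤ 1 := by
  induction n with
  | zero => simp [halfCoeff_zero]
  | succ n ih =>
    rw [halfCoeff_succ]
    have : (n + 1 / 2 : ℝ) / (n + 1) ≤ 1 := by
      rw [div_le_one (by positivity)]
      linarith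
    exact ⟨mul_nonneg (by positivity) ih.1, mul_le_one₀ this ih.1 ih.2⟩

theorem tsum_halfCoeff {x : ℝ} (hx : |x| < 1) :
    ∑' n, halfCoeff n * x ^ n = 1 / Real.sqrt (1 - x) := by
  have h := Real.one_div_one_sub_rpow_hasFPowerSeriesOnBall_zero (1 / 2)
  have h2 := h.hasSum (y := x) (by simpa [enorm_eq_nnnorm] using! hx)
  rw [zero_add, ← Real.sqrt_eq_rpow] at h2
  rw [← h2.tsum_eq]
  refine tsum_congr fun n => ?_
  simp [FormalMultilinearSeries.ofScalars, halfCoeff]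

/-- The power series of the arcsine. -/
theorem tsum_arcsin {t : ℝ} (ht : |t| < 3 / 4) :
    ∑' n : ℕ, halfCoeff n * (t ^ (2 * n + 1) / (2 * n + 1)) = Real.arcsin t := by
  set U : Set ℝ := Metric.ball 0 (3 / 4)
  have hU : IsOpen U := Metric.isOpen_ball
  have hUc : IsPreconnected U := (convex_ball (0 : ℝ) (3 / 4)).isPreconnected
  have mem : ∀ y, y ∈ U ↔ |y| < 3 / 4 := fun y => by simp [U]
  have hd : ∀ y ∈ U, HasDerivAt
      (fun t : ℝ => ∑' n : ℕ, halfCoeff n * (t ^ (2 * n + 1) / (2 * n + 1)))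
      (∑' n : ℕ, halfCoeff n * (y ^ 2) ^ n) y := by
    intro y hy
    -- The radius 3/4 exceeds √2/2, and its square 9/16 is the ratio of the dominating geometric
    -- series. Both sides vanish at 0, so equality of derivatives suffices.
    refine hasDerivAt_tsum_of_isPreconnected (u := fun n : ℕ => (9 / 16 : ℝ) ^ n)
      (g := fun (n : ℕ) (t : ℝ) => halfCoeff n * (t ^ (2 * n + 1) / (2 * n + 1)))
      (g' := fun (n : ℕ) (t : ℝ) => halfCoeff n * (t ^ 2) ^ n) (y₀ := 0)
      (summable_geometric_of_lt_one (by norm_num) (by norm_num)) hU hUc (fun n y _ => ?_)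
      (fun n y hy => ?_) (by simp [U]) ?_ hy
    · have h := ((hasDerivAt_pow (2 * n + 1) y).div_const (2 * n + 1 : ℝ)).const_mul (halfCoeff n)
      refine h.congr_deriv ?_
      have : (2 * n + 1 : ℝ) ≠ 0 := by positivity
      push_cast
      rw [mul_div_cancel_left₀ _ this, pow_mul]
    · have hy' := (mem y).1 hy
      rw [norm_mul, norm_pow, norm_pow, Real.norm_eq_abs, Real.norm_eq_abs,
        abs_of_nonneg (halfCoeff_mem n).1]
      have h1 : |y| ^ 2 ≤ 9 / 16 := by nlinarith [abs_nonneg y]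
      calc _ ≤ 1 * (9 / 16 : ℝ) ^ n :=
            mul_le_mul (halfCoeff_mem n).2 (pow_le_pow_left₀ (by positivity) h1 n)
              (by positivity) zero_le_one
        _ = _ := one_mul _
    · simp
  have hd2 : ∀ y ∈ U, HasDerivAt Real.arcsin (∑' n : ℕ, halfCoeff n * (y ^ 2) ^ n) y := by
    intro y hy
    have hy' := abs_lt.1 ((mem y).1 hy)
    have h := Real.hasDerivAt_arcsin (x := y) (by linarith) (by linarith)
    rwa [tsum_halfCoeff (by rw [abs_of_nonneg (sq_nonneg y)]; nlinarith)]
  have := hU.eqOn_of_deriv_eq hUc (fun y hy => (hd y hy).differentiableAt.differentiableWithinAt)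
    (fun y hy => (hd2 y hy).differentiableAt.differentiableWithinAt)
    (fun y hy => (hd y hy).deriv.trans (hd2 y hy).deriv.symm) (x := 0) (by simp [U]) (by simp)
  exact this ((mem t).2 ht)

/-- (1/2)_n/(3/2)_n = 1/(2n+1), so the series at a = 0 is √2 arcsin(√2/2). -/
theorem secondTerm_zero_left (n : ℕ) : secondTerm 0 n =
    ((Real.sqrt 2 * (halfCoeff n * ((Real.sqrt 2 / 2) ^ (2 * n + 1) / (2 * n + 1))) : ℝ) : ℂ) := by
  have hs : Real.sqrt 2 ^ 2 = 2 := Real.sq_sqrt (by norm_num)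
  have e : ∀ n : ℕ, Real.sqrt 2 * (halfCoeff n * ((Real.sqrt 2 / 2) ^ (2 * n + 1) / (2 * n + 1))) =
      (1 / 2) ^ n * halfCoeff n / (2 * n + 1) := fun n => by
    rw [pow_succ, pow_mul, div_pow, hs]
    norm_num
    field_simp
    linear_combination halfCoeff n * hs
  rw [e]
  induction n with
  | zero => simp [secondTerm_zero, halfCoeff_zero]
  | succ n ih =>
    rw [secondTerm_succ, ih, halfCoeff_succ]
    have n1 : (n : ℂ) + 1 ≠ 0 := by exact_mod_cast n.succ_ne_zero
    have n2 : 2 * (n : ℂ) + 1 ≠ 0 := by exact_mod_cast (2 * n).succ_ne_zero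
    have n3 : 2 * ((n : ℂ) + 1) + 1 ≠ 0 := by exact_mod_cast (2 * (n + 1)).succ_ne_zero
    push_cast
    rw [show (0 : ℂ) + 1 / 2 + n = (2 * n + 1) / 2 by ring,
      show 3 * (0 : ℂ) + 1 / 2 + n = n + 1 / 2 by ring,
      show (3 / 2 : ℂ) - 0 + n = (2 * (n + 1) + 1) / 2 by ring,
      show 2 * (0 : ℂ) + 1 + n = n + 1 by ring, pow_succ]
    field_simp

theorem tsum_secondTerm_zero_left :
    ∑' n, secondTerm 0 n = (Real.sqrt 2 : ℂ) * Real.pi / 4 := by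
  have hs : Real.sqrt 2 ^ 2 = 2 := Real.sq_sqrt (by norm_num)
  have hpos : 0 ≤ Real.sqrt 2 := Real.sqrt_nonneg 2
  have h := tsum_arcsin (t := Real.sqrt 2 / 2) (by
    rw [abs_of_nonneg (by positivity)]
    nlinarith)
  have ha : Real.arcsin (Real.sqrt 2 / 2) = Real.pi / 4 := by
    rw [← Real.sin_pi_div_four]
    exact Real.arcsin_sin (by linarith [Real.pi_pos]) (by linarith [Real.pi_pos])
  rw [tsum_congr secondTerm_zero_left, ← Complex.ofReal_tsum, tsum_mul_left, h, ha]
  push_cast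
  ring

/-- The identity f = C·X + a²k near 0, C being `secondConst` and X the central factor, yields
analyticity there as well as the derivatives. The term a²k affects only the second one, by 2k(0) =
-256√2π, which turns -3π² into -11π². -/
theorem hasJet_ramanujanSeries : HasJet ramanujanSeries (32 * (Real.sqrt 2 : ℂ) / (Real.pi : ℂ))
    (480 * (Real.sqrt 2 : ℂ) / (Real.pi : ℂ) * (Real.log 2 : ℂ))
    (32 * (Real.sqrt 2 : ℂ) / (Real.pi : ℂ) *
      (225 * (Real.log 2 : ℂ) ^ 2 - 11 * (Real.pi : ℂ) ^ 2)) := by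
  have hpi : (Real.pi : ℂ) ≠ 0 := by exact_mod_cast Real.pi_ne_zero
  set k : ℂ → ℂ := fun a => 512 / (2 * a - 1) * ∑' n, secondTerm a n
  have hS : AnalyticAt ℂ (fun a => ∑' n, secondTerm a n) 0 :=
    differentiableOn_tsum_secondTerm.analyticAt ((isOpen_strip _ _).mem_nhds (by norm_num))
  have hk : AnalyticAt ℂ k 0 := by
    refine AnalyticAt.mul (AnalyticAt.div analyticAt_const (by fun_prop) ?_) hS
    simp
  have hk0 : k 0 = -512 * ((Real.sqrt 2 : ℂ) * Real.pi / 4) := by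
    simp only [k, tsum_secondTerm_zero_left]
    norm_num
  -- The derivatives of k may stay unspecified, since the factor a² annihilates them to second
  -- order.
  have hkj : HasJet k _ _ _ := ⟨hk, hk0, rfl, rfl⟩
  have hj := ((hasJet_const secondConst).mul hasJet_centralFactor).add
    ((hasJet_id.mul hasJet_id).mul hkj)
  have he : ramanujanSeries =ᶠ[𝓝 0] fun a => secondConst * centralFactor a + a * a * k a := by
    filter_upwards [eventually_re_lt (r := 1 / 8) (by norm_num)] with a ha
    rw [abs_lt] at ha
    have ha' : ∀ m : ℕ, a ≠ -((m : ℂ) + 1) := by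
      rintro m rfl
      have : (0 : ℝ) ≤ m := m.cast_nonneg
      simp at ha
      linarith
    have hc : Complex.cos (Real.pi * a) ≠ 0 :=
      cos_ne_zero_of_re_mem (by linarith) (by linarith)
    have h := secondDiff_eq ha' hc
    rw [secondClosed_eq_centralFactor (by linarith), secondDiff] at h
    simp only [k]
    linear_combination h
  obtain ⟨j0, j1, j2, j3⟩ := hj.congr he
  refine ⟨j0, ?_, ?_, ?_⟩
  · rw [j1, secondConst]
    ring
  · rw [j2, secondConst]
    ring
  · rw [j3, secondConst]
    field_simp
    ring

end

theorem mainTheorem5 :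
    -- the series defining `f` converges wherever its terms are defined
    (∀ a : ℂ, (∀ m : ℕ, a ≠ -((m : ℂ) + 1)) → Summable (ramanujanTerm a)) ∧
    -- first identity
    (∀ a : ℂ, 0 < a.re →
      Summable (firstTerm a) ∧
      ramanujanSeries a = 128 * a * ∑' n : ℕ, firstTerm a n) ∧
    -- second identity
    (∀ a : ℂ, (∀ m : ℕ, a ≠ -((m : ℂ) + 1)) → Complex.cos (Real.pi * a) ≠ 0 →
      Summable (secondTerm a) ∧
      ramanujanSeries a =
        (32 * (Real.sqrt 2 : ℂ) / (Real.pi : ℂ)) *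
            ((512 : ℂ) ^ a / ((27 : ℂ) ^ a * Complex.cos (Real.pi * a))) *
            (risingC 1 a ^ 3 / (risingC (1 / 2) a * risingC (1 / 6) a * risingC (5 / 6) a)) +
          512 * a ^ 2 / (2 * a - 1) * ∑' n : ℕ, secondTerm a n) ∧
    -- special values
    ramanujanSeries (1 / 2) = 128 * (Real.log 2 : ℂ) ∧
    ramanujanSeries 0 = 32 * (Real.sqrt 2 : ℂ) / (Real.pi : ℂ) ∧
    AnalyticAt ℂ ramanujanSeries 0 ∧
    HasDerivAt ramanujanSeries
      (480 * (Real.sqrt 2 : ℂ) / (Real.pi : ℂ) * (Real.log 2 : ℂ)) 0 ∧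
    HasDerivAt (deriv ramanujanSeries)
      (32 * (Real.sqrt 2 : ℂ) / (Real.pi : ℂ) *
        (225 * (Real.log 2 : ℂ) ^ 2 - 11 * (Real.pi : ℂ) ^ 2)) 0 := by
  obtain ⟨j0, j1, j2, j3⟩ := hasJet_ramanujanSeries
  refine ⟨fun a _ => summable_ramanujanTerm a,
    fun a ha => ⟨summable_firstTerm ha, ramanujanSeries_eq_first ha⟩,
    fun a ha hc => ⟨summable_secondTerm a, ?_⟩, ramanujanSeries_half, j1, j0, ?_, ?_⟩
  · have h := secondDiff_eq ha hc
    rw [secondDiff, sub_eq_iff_eq_add, secondClosed, secondConst, gammaFactor] at h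
    rw [h]
    simp only [div_eq_mul_inv, mul_inv]
    ring
  · rw [← j2]
    exact j0.differentiableAt.hasDerivAt
  · rw [← j3]
    exact j0.deriv.differentiableAt.hasDerivAt
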